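/- Fix $c>0$ and positive integers $m=m_n$ ($n=1,2,\dots$) with $m_n/n\to c$ as $n\to\infty$. Consider the environment $\mathbb C^l$ with $l=1$ and, on one probability space, for every $n\ge 1$ a uniformly distributed random unit vector $v_n\in\mathbb C^l\otimes\mathbb C^{m}\otimes\mathbb C^n$ (the joint law of the $v_n$ for different $n$ is arbitrary). Let $\rho=\operatorname{Tr}_{\mathbb C^l}|v_n\rangle\langle v_n|$ be the induced random (pure) state on $\mathbb C^m\otimes\mathbb C^n$, let $\rho^\Gamma$ be its partial transpose, where the transpose acts on $\mathbb C^n$ only, and let $$\mu_{lm\rho^\Gamma}=\frac1{mn}\sum_{i=1}^{mn}\delta_{\lambda_i},$$ where $\lambda_1,\dots,\lambda_{mn}$ are the eigenvalues of $lm\rho^\Gamma$ counted with multiplicity. For $\lambda\ge 0$ and $\alpha>0$ let $\nu_{\lambda,\alpha}$ be the free Poisson law with rate $\lambda$ and jump size $\alpha$, that is, $\nu_{\lambda,\alpha}=\max(1-\lambda,0)\,\delta_0+\tilde\nu_{\lambda,\alpha}$, where $\tilde\nu_{\lambda,\alpha}$ is carried by $[\alpha(1-\sqrt\lambda)^2,\alpha(1+\sqrt\lambda)^2]$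 and has there the density $$\frac{1}{2\pi\alpha t}\sqrt{4\lambda\alpha^2-(t-\alpha(1+\lambda))^2}.$$ **Theorem.** The signed measure $$\Bigl(1-\frac1c\Bigr)\delta_0+\frac1c\,\mu_{B\sqrt{X_1X_2}}$$ is a probability measure, and almost surely $\mu_{lm\rho^\Gamma}$ converges weakly to it as $n\to\infty$. Here $\mu_{B\sqrt{X_1X_2}}$ is the law of $B\sqrt{X_1X_2}$, where $X_1,X_2$ have the free Poisson law $\nu_{c,1}$ (rate $c$, jump size $1$), $B$ takes the values $1$ and $-1$ with probability $1/2$ each, and $X_1,X_2,B$ are classically independent. -/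

import Mathlib

open MeasureTheory ProbabilityTheory Filter Topology

namespace RandomStates

noncomputable section

/-- The space `ℂ^l ⊗ ℂ^m ⊗ ℂ^n`, in coordinates with respect to the product basis: `ℂ^l` is the
environment, `ℂ^m ⊗ ℂ^n` is the bipartite system. -/
abbrev Space (l m n : ℕ) : Type := EuclideanSpace ℂ (Fin l × Fin m × Fin n)

/-- Unit vectors of `ℂ^l ⊗ ℂ^m ⊗ ℂ^n`. -/
abbrev UnitVector (l m n : ℕ) : Type := Metric.sphere (0 : Space l m n) 1

/-- The uniform distribution on the unit sphere: the surface measure, divided by its total mass. -/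
def uniformUnitVector (l m n : ℕ) : Measure (UnitVector l m n) :=
  ((volume : Measure (Space l m n)).toSphere Set.univ)⁻¹ •
    (volume : Measure (Space l m n)).toSphere

/-- The rank one operator `|v⟩⟨v|`. -/
def pureState {l m n : ℕ} (v : UnitVector l m n) :
    Matrix (Fin l × Fin m × Fin n) (Fin l × Fin m × Fin n) ℂ :=
  Matrix.of fun i j => v.1 i * star (v.1 j)

/-- The partial trace over the environment `ℂ^l`. -/
def traceEnv {l m n : ℕ} (A : Matrix (Fin l × Fin m × Fin n) (Fin l × Fin m × Fin n) ℂ) :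
    Matrix (Fin m × Fin n) (Fin m × Fin n) ℂ :=
  Matrix.of fun i j => ∑ z : Fin l, A (z, i) (z, j)

/-- The partial transpose `A ↦ A^Γ`: the transpose acts on the factor `ℂ^n` only. -/
def partialTranspose {m n : ℕ} (A : Matrix (Fin m × Fin n) (Fin m × Fin n) ℂ) :
    Matrix (Fin m × Fin n) (Fin m × Fin n) ℂ :=
  Matrix.of fun i j => A (i.1, j.2) (j.1, i.2)

/-- The induced state `ρ = Tr_{ℂ^l} |v⟩⟨v|` on `ℂ^m ⊗ ℂ^n`. -/
def inducedState {l m n : ℕ} (v : UnitVector l m n) :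
    Matrix (Fin m × Fin n) (Fin m × Fin n) ℂ :=
  traceEnv (pureState v)

/-- The rescaled partial transpose `l m ρ^Γ`. -/
def rescaledPT {l m n : ℕ} (v : UnitVector l m n) :
    Matrix (Fin m × Fin n) (Fin m × Fin n) ℂ :=
  ((l : ℂ) * (m : ℂ)) • partialTranspose (inducedState v)

theorem rescaledPT_isHermitian {l m n : ℕ} (v : UnitVector l m n) :
    (rescaledPT v).IsHermitian := by
  ext i j
  simp [rescaledPT, partialTranspose, inducedState, traceEnv, pureState, mul_comm]

/-- The empirical eigenvalue distribution of a Hermitian matrix of size `N ≥ 1`: mass `1 / N` at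
each of the `N` eigenvalues, counted with multiplicity. -/
def empiricalDistribution {ι : Type} [Fintype ι] [DecidableEq ι] [Nonempty ι]
    (A : Matrix ι ι ℂ) (hA : A.IsHermitian) : ProbabilityMeasure ℝ :=
  ⟨(Fintype.card ι : ENNReal)⁻¹ • ∑ i : ι, Measure.dirac (hA.eigenvalues i), ⟨by
    simp [ENNReal.inv_mul_cancel]⟩⟩

/-- The empirical eigenvalue distribution of `l m ρ^Γ`. -/
def empiricalPT {l m n : ℕ} [NeZero m] [NeZero n] (v : UnitVector l m n) : ProbabilityMeasure ℝ :=
  empiricalDistribution (rescaledPT v) (rescaledPT_isHermitian v)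

/-- The free Poisson distribution with rate `r ≥ 0` and jump size `α ≠ 0`: an absolutely continuous
part carried by the interval with endpoints `α (1 - √r)²` and `α (1 + √r)²`, and an atom of mass
`1 - r` at `0` if `r < 1` (for `r ≥ 1` the coefficient `ENNReal.ofReal (1 - r)` vanishes). -/
def freePoisson (r α : ℝ) : Measure ℝ :=
  ENNReal.ofReal (1 - r) • Measure.dirac 0 +
    (volume.restrict (Set.uIcc (α * (1 - √r) ^ 2) (α * (1 + √r) ^ 2))).withDensity fun t =>
      ENNReal.ofReal (√(4 * r * α ^ 2 - (t - α * (1 + r)) ^ 2) / (2 * Real.pi * α * t))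

/-- The law of a uniform random sign. -/
def uniformSign : Measure ℝ :=
  (2 : ENNReal)⁻¹ • Measure.dirac 1 + (2 : ENNReal)⁻¹ • Measure.dirac (-1)

/-- The law of `B √(X₁ X₂)` where `B`, `X₁`, `X₂` are independent, `B` is a uniform random sign and
`X₁`, `X₂` both have law `ν`: the image of the product measure. -/
def signedSqrtProductLaw (ν : Measure ℝ) : Measure ℝ :=
  (uniformSign.prod (ν.prod ν)).map fun p => p.1 * √(p.2.1 * p.2.2)

end

end RandomStates

/-! Let `M` be the `m × n` matrix of amplitudes of `v` and `W = M Mᴴ`. The entry of `ρ^Γ` at `(a,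
b), (a', b')` is `M a b' * star (M a' b)`, so `(ρ^Γ) ^ 2 = W ⊗ₖ (Mᴴ M)`. Hence `tr (ρ^Γ) ^ (2k) =
(tr W ^ k) ^ 2` for `k ≥ 1`, whereas an odd power `p` gives the single trace `tr W ^ p`. With `T k =
(m ^ k / n) tr W ^ k`, the moments of the empirical distribution are `(n / m) (T k) ^ 2` and `T p /
m`. If `T k` tends to the `k`-th moment of the free Poisson law, the even moments tend to `1 / c`
times those of `B √(X₁ X₂)` and the odd ones to `0`. The limit has bounded support, so moments
determine the convergence (`tendsto_of_tendsto_moments`).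

The convergence of `T k` rests on loop equations. Gaussian integration by parts expresses the mean
of `T (k+1)` times further power traces through products of total degree one less
(`integral_loop_equation`); homogeneity carries this over to the sphere (`sphere_loop_equation`). Up
to `O(n⁻²)` the recursion closes on products, so means of products factorize with error `O(n⁻²)`
(`isBigO_sphereMoment_sub`). Second moments of the fluctuations are then summable, which gives
almost sure convergence whatever the joint law of the `v n` (`ae_tendsto_powerTrace`).

The limits satisfy a Catalan-type recursion. Since `t` times the free Poisson density is `c` times a
semicircle density of mean `1 + c` and variance `c`, the quadratic equation of the semicircle
generating function identifies them (`loopMoment_succ_eq`, `integral_pow_freePoisson`).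

The signed measure is positive because `B √(X₁ X₂)` vanishes whenever `X₁` does, hence with
probability at least `1 - c`. -/

/-! ### Wirtinger calculus and integration by parts for the complex Gaussian weight. -/

section GaussianIntegration

variable {ι : Type*} [Fintype ι] [DecidableEq ι]

/-- `HasDbar i f g`: the function `f` has temperate growth, and `g` is its Wirtinger derivative with
respect to the conjugate of the `i`-th coordinate. -/
def HasDbar (i : ι) (f g : EuclideanSpace ℂ ι → ℂ) : Prop :=
  f.HasTemperateGrowth ∧ ∀ x, fderiv ℝ f x (EuclideanSpace.single i 1) +
    Complex.I * fderiv ℝ f x (EuclideanSpace.single i Complex.I) = 2 * g x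

/-- The weight `exp (-‖x‖ ^ 2)`, as a complex number. -/
noncomputable def gaussWeight (x : EuclideanSpace ℂ ι) : ℂ := (Real.exp (-‖x‖ ^ 2) : ℂ)

namespace HasDbar

variable {i : ι} {f g f' g' : EuclideanSpace ℂ ι → ℂ}

omit [DecidableEq ι] in
theorem _root_.Function.HasTemperateGrowth.differentiableAt_complex
    (hf : f.HasTemperateGrowth) (x : EuclideanSpace ℂ ι) : DifferentiableAt ℝ f x :=
  (hf.1.differentiable (by simp)) x

theorem const (c : ℂ) : HasDbar i (fun _ => c) (fun _ => 0) :=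
  ⟨Function.HasTemperateGrowth.const c, fun x => by simp⟩

theorem add (hf : HasDbar i f f') (hg : HasDbar i g g') :
    HasDbar i (fun x => f x + g x) (fun x => f' x + g' x) := by
  refine ⟨hf.1.fun_add hg.1, fun x => ?_⟩
  rw [fderiv_fun_add (hf.1.differentiableAt_complex x) (hg.1.differentiableAt_complex x)]
  simp only [_root_.add_apply]
  linear_combination hf.2 x + hg.2 x

theorem mul (hf : HasDbar i f f') (hg : HasDbar i g g') :
    HasDbar i (fun x => f x * g x) (fun x => f' x * g x + f x * g' x) := by
  refine ⟨hf.1.fun_mul hg.1, fun x => ?_⟩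
  rw [fderiv_fun_mul (hf.1.differentiableAt_complex x) (hg.1.differentiableAt_complex x)]
  simp only [_root_.add_apply, _root_.smul_apply, smul_eq_mul]
  linear_combination g x * hf.2 x + f x * hg.2 x

theorem sum {κ : Type*} (s : Finset κ) {F F' : κ → EuclideanSpace ℂ ι → ℂ}
    (h : ∀ k ∈ s, HasDbar i (F k) (F' k)) :
    HasDbar i (fun x => ∑ k ∈ s, F k x) (fun x => ∑ k ∈ s, F' k x) := by
  classical
  induction s using Finset.induction_on with
  | empty => simpa using const 0
  | insert a s ha ih =>
    simp only [Finset.sum_insert ha]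
    exact (h a (Finset.mem_insert_self a s)).add
      (ih fun k hk => h k (Finset.mem_insert_of_mem hk))

theorem congr_deriv (hf : HasDbar i f f') (h : ∀ x, f' x = g' x) : HasDbar i f g' :=
  ⟨hf.1, fun x => by rw [hf.2 x, h x]⟩

theorem coord (j : ι) : HasDbar i (fun x => x j) (fun _ => 0) := by
  have h : (fun x : EuclideanSpace ℂ ι => x j) =
      (EuclideanSpace.proj j : EuclideanSpace ℂ ι →L[ℂ] ℂ).restrictScalars ℝ := rfl
  refine ⟨by rw [h]; exact ContinuousLinearMap.hasTemperateGrowth _, fun x => ?_⟩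
  rw [h, ContinuousLinearMap.fderiv]
  by_cases hij : j = i
  · subst hij; simp
  · simp [hij]

theorem conj_coord (j : ι) :
    HasDbar i (fun x => star (x j)) (fun _ => if j = i then 1 else 0) := by
  have h : (fun x : EuclideanSpace ℂ ι => star (x j)) =
      (Complex.conjCLE : ℂ →L[ℝ] ℂ).comp
        ((EuclideanSpace.proj j : EuclideanSpace ℂ ι →L[ℂ] ℂ).restrictScalars ℝ) := rfl
  refine ⟨by rw [h]; exact ContinuousLinearMap.hasTemperateGrowth _, fun x => ?_⟩
  rw [h, ContinuousLinearMap.fderiv]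
  by_cases hij : j = i
  · subst hij; simp; norm_num
  · simp [hij]

/-- Needed to differentiate the weight: it yields `∂̄ᵢ exp (-‖x‖²) = -xᵢ exp (-‖x‖²)`. -/
theorem norm_sq : HasDbar i (fun x : EuclideanSpace ℂ ι => ((‖x‖ ^ 2 : ℝ) : ℂ)) (fun x => x i) := by
  have h : (fun x : EuclideanSpace ℂ ι => ((‖x‖ ^ 2 : ℝ) : ℂ)) =
      fun x => ∑ j, x j * star (x j) := by
    ext x
    rw [EuclideanSpace.norm_sq_eq]
    push_cast
    refine Finset.sum_congr rfl fun j _ => ?_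
    rw [← Complex.ofReal_pow, ← Complex.normSq_eq_norm_sq, ← Complex.mul_conj]; rfl
  rw [h]
  refine (sum Finset.univ fun j _ => (coord j).mul (conj_coord j)).congr_deriv fun x => ?_
  simp

end HasDbar

omit [DecidableEq ι] in
theorem gaussWeight_eq (x : EuclideanSpace ℂ ι) :
    gaussWeight x = Complex.exp (-((‖x‖ ^ 2 : ℝ) : ℂ)) := by
  simp [gaussWeight]

theorem one_add_pow_mul_exp_neg_sq_le (k : ℕ) (r : ℝ) (hr : 0 ≤ r) :
    (1 + r) ^ k * Real.exp (-r ^ 2) ≤ (k.factorial * Real.exp 2) * Real.exp (-(r ^ 2) / 2) := by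
  have h1 : (1 + r) ^ k ≤ k.factorial * Real.exp (1 + r) := by
    have := Real.pow_div_factorial_le_exp (1 + r) (by linarith) k
    rwa [div_le_iff₀ (by positivity), mul_comm] at this
  calc (1 + r) ^ k * Real.exp (-r ^ 2) ≤ (k.factorial * Real.exp (1 + r)) * Real.exp (-r ^ 2) := by
        gcongr
    _ = k.factorial * Real.exp (1 + r - r ^ 2) := by
        rw [mul_assoc, ← Real.exp_add]; ring_nf
    _ ≤ k.factorial * Real.exp (2 + -(r ^ 2) / 2) := by
        gcongr; nlinarith [sq_nonneg (r - 1)]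
    _ = _ := by rw [Real.exp_add]; ring

omit [DecidableEq ι] in
theorem integrable_exp_neg_norm_sq_half :
    Integrable (fun x : EuclideanSpace ℂ ι => Real.exp (-(‖x‖ ^ 2) / 2)) := by
  have := (GaussianFourier.integrable_cexp_neg_mul_sq_norm_add (V := EuclideanSpace ℂ ι)
    (b := 1/2) (by norm_num) 0 0).norm
  refine this.congr (Eventually.of_forall fun x => ?_)
  simp only [Complex.norm_exp]
  congr 1
  simp [← Complex.ofReal_pow]
  ring

omit [DecidableEq ι] in
theorem integrable_mul_gaussWeight {f : EuclideanSpace ℂ ι → ℂ} (hf : Continuous f) {k : ℕ} {C : ℝ}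
    (h : ∀ x, ‖f x‖ ≤ C * (1 + ‖x‖) ^ k) : Integrable (fun x => f x * gaussWeight x) := by
  refine ((integrable_exp_neg_norm_sq_half (ι := ι)).const_mul
    (C * (k.factorial * Real.exp 2))).mono' ?_ (Eventually.of_forall fun x => ?_)
  · refine Continuous.aestronglyMeasurable ?_
    unfold gaussWeight
    fun_prop
  · have hC : 0 ≤ C := by
      have := (norm_nonneg _).trans (h 0)
      simpa using this
    rw [norm_mul, gaussWeight, Complex.norm_real, Real.norm_eq_abs, abs_of_pos (Real.exp_pos _)]
    calc ‖f x‖ * Real.exp (-‖x‖ ^ 2) ≤ C * (1 + ‖x‖) ^ k * Real.exp (-‖x‖ ^ 2) := by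
          gcongr; exact h x
      _ ≤ _ := by
          rw [mul_assoc, mul_assoc]
          exact mul_le_mul_of_nonneg_left
            (one_add_pow_mul_exp_neg_sq_le k _ (norm_nonneg x)) hC

omit [DecidableEq ι] in
theorem Function.HasTemperateGrowth.integrable_mul_gaussWeight {f : EuclideanSpace ℂ ι → ℂ}
    (hf : f.HasTemperateGrowth) : Integrable (fun x => f x * gaussWeight x) := by
  obtain ⟨k, C, h⟩ := hf.2 0
  exact _root_.integrable_mul_gaussWeight hf.1.continuous (k := k) (C := C) (by simpa using h)

omit [DecidableEq ι] in
theorem Function.HasTemperateGrowth.integrable_fderiv_mul_gaussWeight {f : EuclideanSpace ℂ ι → ℂ}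
    (hf : f.HasTemperateGrowth) (v : EuclideanSpace ℂ ι) :
    Integrable (fun x => fderiv ℝ f x v * gaussWeight x) := by
  obtain ⟨k, C, h⟩ := hf.2 1
  refine _root_.integrable_mul_gaussWeight (k := k) (C := C * ‖v‖) ?_ fun x => ?_
  · exact (hf.1.continuous_fderiv (by simp)).clm_apply continuous_const
  · calc ‖fderiv ℝ f x v‖ ≤ ‖fderiv ℝ f x‖ * ‖v‖ := ContinuousLinearMap.le_opNorm _ _
      _ ≤ C * (1 + ‖x‖) ^ k * ‖v‖ := by
        gcongr
        simpa [norm_iteratedFDeriv_one] using h x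
      _ = _ := by ring

theorem hasFDerivAt_gaussWeight (x : EuclideanSpace ℂ ι) :
    ∃ L : EuclideanSpace ℂ ι →L[ℝ] ℂ, HasFDerivAt gaussWeight (gaussWeight x • -L) x ∧
      L = fderiv ℝ (fun x : EuclideanSpace ℂ ι => ((‖x‖ ^ 2 : ℝ) : ℂ)) x := by
  refine ⟨_, ?_, rfl⟩
  have h : (gaussWeight : EuclideanSpace ℂ ι → ℂ) =
      fun x => Complex.exp (-((‖x‖ ^ 2 : ℝ) : ℂ)) := funext gaussWeight_eq
  rw [h]
  refine HasFDerivAt.cexp (HasFDerivAt.fun_neg ?_)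
  refine DifferentiableAt.hasFDerivAt ?_
  have : (fun x : EuclideanSpace ℂ ι => ((‖x‖ ^ 2 : ℝ) : ℂ)).HasTemperateGrowth := by
    -- `HasDbar.norm_sq` refers to a coordinate, so the zero-dimensional space is treated apart.
    rcases isEmpty_or_nonempty ι with hι | ⟨⟨i⟩⟩
    · have : (fun x : EuclideanSpace ℂ ι => ((‖x‖ ^ 2 : ℝ) : ℂ)) = fun _ => 0 := by
        ext x
        simp [EuclideanSpace.norm_sq_eq]
      rw [this]
      exact Function.HasTemperateGrowth.const 0
    · exact (HasDbar.norm_sq (i := i)).1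
  exact this.differentiableAt_complex x

/-- Integration by parts for the Gaussian weight. -/
theorem HasDbar.integral_mul_gaussWeight {i : ι} {f f' : EuclideanSpace ℂ ι → ℂ}
    (hf : HasDbar i f f') :
    ∫ x, f' x * gaussWeight x = ∫ x, x i * f x * gaussWeight x := by
  have hγ (x : EuclideanSpace ℂ ι) (v : EuclideanSpace ℂ ι) : fderiv ℝ gaussWeight x v =
      -(fderiv ℝ (fun x : EuclideanSpace ℂ ι => ((‖x‖ ^ 2 : ℝ) : ℂ)) x v) * gaussWeight x := by
    obtain ⟨L, h1, h2⟩ := hasFDerivAt_gaussWeight x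
    rw [h1.fderiv, ← h2]
    simp [mul_comm]
  have hI (v : EuclideanSpace ℂ ι) :
      Integrable (fun x => f x * fderiv ℝ gaussWeight x v) := by
    simp_rw [hγ]
    have hq := (HasDbar.norm_sq (i := i)).1
    obtain ⟨k, C, h⟩ := hq.2 1
    obtain ⟨k', C', h'⟩ := hf.1.2 0
    have : Integrable (fun x : EuclideanSpace ℂ ι => (f x *
        -(fderiv ℝ (fun x : EuclideanSpace ℂ ι => ((‖x‖ ^ 2 : ℝ) : ℂ)) x v)) * gaussWeight x) := by
      refine _root_.integrable_mul_gaussWeight (k := k' + k) (C := C' * (C * ‖v‖)) ?_ fun x => ?_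
      · exact hf.1.1.continuous.mul
          ((hq.1.continuous_fderiv (by simp)).clm_apply continuous_const).neg
      · rw [norm_mul, norm_neg, pow_add]
        have h1 : ‖f x‖ ≤ C' * (1 + ‖x‖) ^ k' := by simpa using h' x
        have h2 : ‖fderiv ℝ (fun x : EuclideanSpace ℂ ι => ((‖x‖ ^ 2 : ℝ) : ℂ)) x v‖ ≤
            C * (1 + ‖x‖) ^ k * ‖v‖ := by
          refine (ContinuousLinearMap.le_opNorm _ _).trans ?_
          gcongr
          simpa [norm_iteratedFDeriv_one] using h x
        calc _ ≤ (C' * (1 + ‖x‖) ^ k') * (C * (1 + ‖x‖) ^ k * ‖v‖) :=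
              mul_le_mul h1 h2 (norm_nonneg _) ((norm_nonneg _).trans h1)
          _ = _ := by ring
    simpa only [mul_assoc] using this
  have key (v : EuclideanSpace ℂ ι) : ∫ x, f x * fderiv ℝ gaussWeight x v =
      - ∫ x, fderiv ℝ f x v * gaussWeight x :=
    integral_mul_fderiv_eq_neg_fderiv_mul_of_integrable (𝕜 := ℂ)
      (hf.1.integrable_fderiv_mul_gaussWeight v) (hI v) hf.1.integrable_mul_gaussWeight
      (fun x _ => hf.1.differentiableAt_complex x)
      (fun x _ => (hasFDerivAt_gaussWeight x).choose_spec.1.differentiableAt)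
  have e1 : ∫ x, (f x * fderiv ℝ gaussWeight x (EuclideanSpace.single i 1) + Complex.I *
      (f x * fderiv ℝ gaussWeight x (EuclideanSpace.single i Complex.I))) =
      -∫ x, (fderiv ℝ f x (EuclideanSpace.single i 1) * gaussWeight x + Complex.I *
        (fderiv ℝ f x (EuclideanSpace.single i Complex.I) * gaussWeight x)) := by
    rw [integral_add (hI _) ((hI _).const_mul _), integral_add
      (hf.1.integrable_fderiv_mul_gaussWeight _)
      ((hf.1.integrable_fderiv_mul_gaussWeight _).const_mul _),
      integral_const_mul, integral_const_mul, key, key]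
    ring
  have e2 : ∀ x, f x * fderiv ℝ gaussWeight x (EuclideanSpace.single i 1) + Complex.I *
      (f x * fderiv ℝ gaussWeight x (EuclideanSpace.single i Complex.I)) =
      (-2) * (x i * f x * gaussWeight x) := by
    intro x
    rw [hγ, hγ]
    linear_combination (-f x * gaussWeight x) * (HasDbar.norm_sq (i := i)).2 x
  have e3 : ∀ x, fderiv ℝ f x (EuclideanSpace.single i 1) * gaussWeight x + Complex.I *
        (fderiv ℝ f x (EuclideanSpace.single i Complex.I) * gaussWeight x) =
      2 * (f' x * gaussWeight x) := by
    intro x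
    linear_combination gaussWeight x * hf.2 x
  simp_rw [e2, e3] at e1
  rw [integral_const_mul, integral_const_mul] at e1
  linear_combination e1 / 2

omit [DecidableEq ι] in
/-- Polar coordinates: the Gaussian integral of a homogeneous function. -/
theorem integral_mul_gaussWeight_eq_toSphere [Nonempty ι] {f : EuclideanSpace ℂ ι → ℂ} {d : ℕ}
    (hf : ∀ (r : ℝ) (x : EuclideanSpace ℂ ι), 0 < r → f (r • x) = (r : ℂ) ^ (2 * d) * f x) :
    ∫ x, f x * gaussWeight x =
      (∫ u, f u.1 ∂(volume : Measure (EuclideanSpace ℂ ι)).toSphere) *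
        ((Real.Gamma (Fintype.card ι + d) / 2 : ℝ) : ℂ) := by
  have hN : 0 < Fintype.card ι := Fintype.card_pos
  have hdim : Module.finrank ℝ (EuclideanSpace ℂ ι) = 2 * Fintype.card ι := by
    rw [← Module.finrank_mul_finrank ℝ ℂ, Complex.finrank_real_complex, finrank_euclideanSpace]
  -- The real dimension is twice the number `N` of complex coordinates, so the radial integral is
  -- that of `r ^ (2N - 1 + 2d) exp (-r²)`, equal to `Γ(N + d) / 2`.
  have hrad : ∫ r : Set.Ioi (0 : ℝ), (((r : ℝ) ^ (2 * d) * Real.exp (-(r : ℝ) ^ 2) : ℝ) : ℂ)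
      ∂(Measure.volumeIoiPow (2 * Fintype.card ι - 1)) =
      ((Real.Gamma (Fintype.card ι + d) / 2 : ℝ) : ℂ) := by
    rw [integral_complex_ofReal]
    congr 1
    simp only [Measure.volumeIoiPow, ENNReal.ofReal]
    rw [integral_withDensity_eq_integral_smul
      ((measurable_subtype_coe.pow_const _).real_toNNReal),
      integral_subtype_comap measurableSet_Ioi fun a : ℝ =>
        Real.toNNReal (a ^ (2 * Fintype.card ι - 1)) • (a ^ (2 * d) * Real.exp (-a ^ 2))]
    have := integral_rpow_mul_exp_neg_rpow (p := 2) (q := 2 * Fintype.card ι - 1 + 2 * d)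
      (by norm_num) (by
        have : (1 : ℝ) ≤ Fintype.card ι := by exact_mod_cast hN
        nlinarith [(Nat.cast_nonneg d : (0 : ℝ) ≤ d)])
    rw [show ((2 : ℝ) * Fintype.card ι - 1 + 2 * d + 1) / 2 = Fintype.card ι + d by ring] at this
    rw [show Real.Gamma (Fintype.card ι + d) / 2 = 1 / 2 * Real.Gamma (Fintype.card ι + d) by ring,
      ← this]
    refine setIntegral_congr_fun measurableSet_Ioi fun r hr => ?_
    have hr' : (0 : ℝ) < r := hr
    rw [NNReal.smul_def, Real.coe_toNNReal _ (pow_nonneg hr'.le _), smul_eq_mul, ← mul_assoc,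
      ← pow_add, Real.rpow_two]
    congr 1
    rw [← Real.rpow_natCast]
    congr 1
    push_cast [show 1 ≤ 2 * Fintype.card ι by omega]
    ring
  calc ∫ x, f x * gaussWeight x
      = ∫ x : ({(0 : EuclideanSpace ℂ ι)}ᶜ : Set _), f x.1 * gaussWeight x.1
          ∂((volume : Measure (EuclideanSpace ℂ ι)).comap (↑)) := by
        rw [integral_subtype_comap (measurableSet_singleton _).compl
          fun x => f x * gaussWeight x, restrict_compl_singleton]
    _ = ∫ p, f p.1.1 * (((p.2 : ℝ) ^ (2 * d) * Real.exp (-(p.2 : ℝ) ^ 2) : ℝ) : ℂ)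
          ∂(volume : Measure (EuclideanSpace ℂ ι)).toSphere.prod
            (.volumeIoiPow (Module.finrank ℝ (EuclideanSpace ℂ ι) - 1)) := by
        rw [← ((volume : Measure (EuclideanSpace ℂ ι)).measurePreserving_homeomorphUnitSphereProd
          ).integral_comp (Homeomorph.measurableEmbedding _)]
        refine integral_congr_ae (Eventually.of_forall fun x => ?_)
        have hx : 0 < ‖x.1‖ := norm_pos_iff.2 x.2
        have h := hf ‖x.1‖ (‖x.1‖⁻¹ • x.1) hx
        rw [smul_smul, mul_inv_cancel₀ hx.ne', one_smul] at h
        simp only [homeomorphUnitSphereProd_apply_fst_coe, homeomorphUnitSphereProd_apply_snd_coe]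
        rw [h, gaussWeight]
        push_cast
        ring
    _ = _ := by
        rw [integral_prod_mul (fun u : Metric.sphere (0 : EuclideanSpace ℂ ι) 1 => f u.1)
          (fun r : Set.Ioi (0 : ℝ) => (((r : ℝ) ^ (2 * d) * Real.exp (-(r : ℝ) ^ 2) : ℝ) : ℂ)),
          hdim, hrad]

end GaussianIntegration

/-! ### Loop equations for power traces under the Gaussian weight. -/

section TraceMoments

open RandomStates Matrix

/-- `HasDbar` for a matrix valued function, entry by entry. -/
def HasMatrixDbar {ι α β : Type*} [Fintype ι] [DecidableEq ι] (i : ι)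
    (A A' : EuclideanSpace ℂ ι → Matrix α β ℂ) : Prop :=
  ∀ a b, HasDbar i (fun x => A x a b) (fun x => A' x a b)

theorem HasMatrixDbar.mul {ι α β δ : Type*} [Fintype ι] [DecidableEq ι] [Fintype β] {i : ι}
    {A A' : EuclideanSpace ℂ ι → Matrix α β ℂ} {B B' : EuclideanSpace ℂ ι → Matrix β δ ℂ}
    (hA : HasMatrixDbar i A A') (hB : HasMatrixDbar i B B') :
    HasMatrixDbar i (fun x => A x * B x) (fun x => A' x * B x + A x * B' x) := by
  intro a b
  simp only [Matrix.mul_apply, Matrix.add_apply]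
  refine (HasDbar.sum Finset.univ fun k _ => (hA a k).mul (hB k b)).congr_deriv fun x => ?_
  rw [Finset.sum_add_distrib]

theorem HasMatrixDbar.trace {ι α : Type*} [Fintype ι] [DecidableEq ι] [Fintype α] {i : ι}
    {A A' : EuclideanSpace ℂ ι → Matrix α α ℂ} (hA : HasMatrixDbar i A A') :
    HasDbar i (fun x => (A x).trace) (fun x => (A' x).trace) :=
  HasDbar.sum Finset.univ fun k _ => hA k k

variable {m n : ℕ}

/-- The matrix of amplitudes of a vector of `ℂ^m ⊗ ℂ^n`. -/
def amplitudes (x : Space 1 m n) : Matrix (Fin m) (Fin n) ℂ := Matrix.of fun a b => x (0, a, b)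

/-- The reduced operator `M Mᴴ` on `ℂ^m`, where `M` is the matrix of amplitudes. -/
def reducedOperator (x : Space 1 m n) : Matrix (Fin m) (Fin m) ℂ := amplitudes x * (amplitudes x)ᴴ

/-- The rescaled power trace `(m ^ k / n) tr ((M Mᴴ) ^ k)`. -/
noncomputable def powerTrace (k : ℕ) (x : Space 1 m n) : ℂ :=
  (m : ℂ) ^ k / n * (reducedOperator x ^ k).trace

/-- A product of rescaled power traces. -/
noncomputable def powerTraceProd (l : List ℕ) (x : Space 1 m n) : ℂ :=
  (l.map fun k => powerTrace k x).prod

/-- The sum of the products obtained from `powerTraceProd l` by merging one factor with a power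
trace of order `k`. -/
noncomputable def mergedProd (k : ℕ) : List ℕ → Space 1 m n → ℂ
  | [], _ => 0
  | r :: l, x => r * powerTrace (k + r) x * powerTraceProd l x + powerTrace r x * mergedProd k l x

@[simp] theorem powerTraceProd_nil (x : Space 1 m n) : powerTraceProd [] x = 1 := rfl

@[simp] theorem powerTraceProd_cons (k : ℕ) (l : List ℕ) (x : Space 1 m n) :
    powerTraceProd (k :: l) x = powerTrace k x * powerTraceProd l x := by
  simp [powerTraceProd]

theorem hasMatrixDbar_amplitudes (p : Fin m) (q : Fin n) :
    HasMatrixDbar ((0 : Fin 1), p, q) (fun x : Space 1 m n => amplitudes x) (fun _ => 0) :=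
  fun a b => HasDbar.coord ((0 : Fin 1), a, b)

theorem hasMatrixDbar_conjTranspose_amplitudes (p : Fin m) (q : Fin n) :
    HasMatrixDbar ((0 : Fin 1), p, q) (fun x : Space 1 m n => (amplitudes x)ᴴ)
      (fun _ => Matrix.single q p (1 : ℂ)) := by
  intro b a
  refine (HasDbar.conj_coord ((0 : Fin 1), a, b)).congr_deriv fun x => ?_
  simp [Matrix.single_apply, eq_comm, and_comm]

theorem hasMatrixDbar_reducedOperator (p : Fin m) (q : Fin n) :
    HasMatrixDbar ((0 : Fin 1), p, q) (fun x : Space 1 m n => reducedOperator x)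
      (fun x => amplitudes x * Matrix.single q p (1 : ℂ)) := by
  have := (hasMatrixDbar_amplitudes p q).mul (hasMatrixDbar_conjTranspose_amplitudes p q)
  simpa [reducedOperator] using this

/-- Noncommutative Leibniz rule. The truncated subtraction is harmless, since `a < k` throughout the
sum. -/
theorem hasMatrixDbar_reducedOperator_pow (p : Fin m) (q : Fin n) (k : ℕ) :
    HasMatrixDbar ((0 : Fin 1), p, q) (fun x : Space 1 m n => reducedOperator x ^ k)
      (fun x => ∑ a ∈ Finset.range k, reducedOperator x ^ a *
        (amplitudes x * Matrix.single q p (1 : ℂ)) * reducedOperator x ^ (k - 1 - a)) := by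
  induction k with
  | zero =>
    intro a b
    simpa using HasDbar.const _
  | succ k ih =>
    have := ih.mul (hasMatrixDbar_reducedOperator p q)
    intro a b
    simp only [pow_succ]
    refine (this a b).congr_deriv fun x => ?_
    beta_reduce
    rw [Finset.sum_range_succ, Finset.sum_mul]
    simp only [Nat.add_sub_cancel, Nat.sub_self, pow_zero, mul_one]
    refine congrFun (congrFun (congrArg (· + _) (Finset.sum_congr rfl fun c hc => ?_)) a) b
    have : k - c = k - 1 - c + 1 := by have := Finset.mem_range.1 hc; omega
    rw [this, pow_succ]
    simp only [Matrix.mul_assoc]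

/-- Under the trace, cyclicity makes the `k` Leibniz terms equal. For `k = 0` the factor `k` cancels
the meaningless exponent `k - 1`. -/
theorem hasDbar_powerTrace (p : Fin m) (q : Fin n) (k : ℕ) :
    HasDbar ((0 : Fin 1), p, q) (fun x : Space 1 m n => powerTrace k x)
      (fun x => (m : ℂ) ^ k / n * (k * (reducedOperator x ^ (k - 1) * amplitudes x) p q)) := by
  refine ((HasDbar.const ((m : ℂ) ^ k / n)).mul
    (hasMatrixDbar_reducedOperator_pow p q k).trace).congr_deriv fun x => ?_
  rw [zero_mul, zero_add, Matrix.trace_sum, ← nsmul_eq_mul, ← Finset.card_range k,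
    ← Finset.sum_const]
  simp only [Finset.card_range]
  congr 1
  refine Finset.sum_congr rfl fun a ha => ?_
  rw [Matrix.trace_mul_comm, ← Matrix.mul_assoc, ← pow_add, ← Matrix.mul_assoc,
    show k - 1 - a + a = k - 1 by have := Finset.mem_range.1 ha; omega, Matrix.trace_mul_single]
  simp

/-- The Wirtinger derivative of a product of power traces. -/
noncomputable def dbarPowerTraceProd (p : Fin m) (q : Fin n) : List ℕ → Space 1 m n → ℂ
  | [], _ => 0
  | r :: l, x => (m : ℂ) ^ r / n * (r * (reducedOperator x ^ (r - 1) * amplitudes x) p q) *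
      powerTraceProd l x + powerTrace r x * dbarPowerTraceProd p q l x

theorem hasDbar_powerTraceProd (p : Fin m) (q : Fin n) (l : List ℕ) :
    HasDbar ((0 : Fin 1), p, q) (fun x : Space 1 m n => powerTraceProd l x)
      (dbarPowerTraceProd p q l) := by
  induction l with
  | nil => exact HasDbar.const 1
  | cons r l ih =>
    simp only [powerTraceProd_cons]
    exact (hasDbar_powerTrace p q r).mul ih

/-- Contracting the derivative of `tr W ^ r` with `Mᴴ W ^ k` glues the two into `r tr W ^ (k + r)`.
Two traces become one, which is why this term carries a factor `n⁻²` in the loop equation. -/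
theorem sum_mul_dbarPowerTraceProd [NeZero m] (k : ℕ) (l : List ℕ) (x : Space 1 m n) :
    ∑ p, ∑ q, ((amplitudes x)ᴴ * reducedOperator x ^ k) q p * dbarPowerTraceProd p q l x =
      ((m : ℂ) ^ k)⁻¹ * mergedProd k l x := by
  have hm : (m : ℂ) ≠ 0 := NeZero.ne _
  induction l with
  | nil => simp [dbarPowerTraceProd, mergedProd]
  | cons r l ih =>
    simp only [dbarPowerTraceProd, mergedProd, mul_add, Finset.sum_add_distrib]
    congr 1
    · have h : (r : ℂ) * ∑ p, ∑ q, (reducedOperator x ^ (r - 1) * amplitudes x) p q *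
          ((amplitudes x)ᴴ * reducedOperator x ^ k) q p =
          r * (reducedOperator x ^ (k + r)).trace := by
        rcases Nat.eq_zero_or_pos r with rfl | hr
        · simp
        · congr 1
          have : reducedOperator x ^ (k + r) = (reducedOperator x ^ (r - 1) * amplitudes x) *
              ((amplitudes x)ᴴ * reducedOperator x ^ k) := by
            rw [Matrix.mul_assoc, ← Matrix.mul_assoc (amplitudes x)]
            change _ = _ * (reducedOperator x * _)
            rw [← pow_succ', ← pow_add]
            congr 1; omega
          rw [this]
          simp only [Matrix.trace, Matrix.diag]
          exact Finset.sum_congr rfl fun p _ => (Matrix.mul_apply ..).symm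
      calc _ = (m : ℂ) ^ r / n * ((r : ℂ) * ∑ p, ∑ q,
            (reducedOperator x ^ (r - 1) * amplitudes x) p q *
            ((amplitudes x)ᴴ * reducedOperator x ^ k) q p) * powerTraceProd l x := by
            simp only [Finset.mul_sum, Finset.sum_mul]
            refine Finset.sum_congr rfl fun p _ => Finset.sum_congr rfl fun q _ => ?_
            ring
        _ = _ := by
            rw [h, powerTrace, pow_add (m : ℂ)]
            field_simp
    · rw [mul_left_comm, ← ih]
      simp only [Finset.mul_sum]
      refine Finset.sum_congr rfl fun p _ => Finset.sum_congr rfl fun q _ => ?_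
      ring

/-- The right hand side of the loop equation. -/
noncomputable def loopTerm (k : ℕ) (l : List ℕ) (x : Space 1 m n) : ℂ :=
  powerTraceProd (k :: l) x +
    (∑ a ∈ Finset.range k, powerTraceProd ((a + 1) :: (k - 1 - a) :: l) x) +
    ((n : ℂ) ^ 2)⁻¹ * mergedProd k l x

theorem trace_mul_pow_amplitudes (a : ℕ) (x : Space 1 m n) :
    ((amplitudes x)ᴴ * reducedOperator x ^ a * amplitudes x).trace =
      (reducedOperator x ^ (a + 1)).trace := by
  rw [Matrix.trace_mul_comm, ← Matrix.mul_assoc, pow_succ']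
  rfl

/-- Write `tr W ^ (k+1) = ∑ x_{pq} (Mᴴ W ^ k)_{qp}` and integrate by parts in each `x_{pq}`. The
derivative of the leading `Mᴴ` gives `n tr W ^ k`, those of the factors of `W ^ k` split the trace
in two, and those of the remaining power traces merge traces. -/
theorem integral_loop_equation [NeZero m] [NeZero n] (k : ℕ) (l : List ℕ) :
    ∫ x : Space 1 m n, powerTraceProd ((k + 1) :: l) x * gaussWeight x =
      ((m : ℂ) * n) * ∫ x : Space 1 m n, loopTerm k l x * gaussWeight x := by
  have hm : (m : ℂ) ≠ 0 := NeZero.ne _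
  have hn : (n : ℂ) ≠ 0 := NeZero.ne _
  have hbase (p : Fin m) (q : Fin n) := (hasMatrixDbar_conjTranspose_amplitudes p q).mul
    (hasMatrixDbar_reducedOperator_pow p q k)
  have hd (p : Fin m) (q : Fin n) := (hbase p q q p).mul (hasDbar_powerTraceProd p q l)
  have hibp (p : Fin m) (q : Fin n) := (hd p q).integral_mul_gaussWeight
  have hint (p : Fin m) (q : Fin n) : Integrable fun x : Space 1 m n =>
      x (0, p, q) * (((amplitudes x)ᴴ * reducedOperator x ^ k) q p * powerTraceProd l x) *
        gaussWeight x :=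
    (((HasDbar.coord (i := ((0 : Fin 1), p, q)) ((0 : Fin 1), p, q)).mul
      (hd p q)).1).integrable_mul_gaussWeight
  -- `HasDbar` asserts temperate growth of `f` only, so the integrability of `f'` is read off from
  -- the real derivatives.
  have hintd {i : Fin 1 × Fin m × Fin n} {f f' : Space 1 m n → ℂ} (h : HasDbar i f f') :
      Integrable fun x => f' x * gaussWeight x := by
    have : (fun x => f' x * gaussWeight x) = fun x => (1 / 2 : ℂ) *
        (fderiv ℝ f x (EuclideanSpace.single i 1) * gaussWeight x + Complex.I *
          (fderiv ℝ f x (EuclideanSpace.single i Complex.I) * gaussWeight x)) := by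
      ext x
      linear_combination (-gaussWeight x / 2) * h.2 x
    rw [this]
    exact ((h.1.integrable_fderiv_mul_gaussWeight _).add
      ((h.1.integrable_fderiv_mul_gaussWeight _).const_mul _)).const_mul _
  have hL : ∀ x : Space 1 m n, powerTraceProd ((k + 1) :: l) x * gaussWeight x =
      ((m : ℂ) ^ (k + 1) / n) * ∑ p, ∑ q, x (0, p, q) *
        (((amplitudes x)ᴴ * reducedOperator x ^ k) q p * powerTraceProd l x) * gaussWeight x := by
    intro x
    have : (reducedOperator x ^ (k + 1)).trace = ∑ p, ∑ q, x (0, p, q) *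
        ((amplitudes x)ᴴ * reducedOperator x ^ k) q p := by
      rw [pow_succ']
      change (amplitudes x * (amplitudes x)ᴴ * _).trace = _
      rw [Matrix.mul_assoc]
      simp only [Matrix.trace, Matrix.diag, Matrix.mul_apply (M := amplitudes x)]
      rfl
    rw [powerTraceProd_cons, powerTrace, this]
    simp only [Finset.mul_sum, Finset.sum_mul]
    refine Finset.sum_congr rfl fun p _ => Finset.sum_congr rfl fun q _ => ?_
    ring
  simp_rw [hL]
  rw [integral_const_mul, integral_finsetSum _ fun p _ => integrable_finsetSum _ fun q _ =>
    hint p q]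
  simp_rw [integral_finsetSum _ fun q _ => hint _ q, ← hibp]
  simp_rw [← integral_finsetSum Finset.univ fun q _ => hintd (hd _ q)]
  rw [← integral_finsetSum _ fun p _ => integrable_finsetSum _ fun q _ => hintd (hd p q),
    ← integral_const_mul, ← integral_const_mul]
  congr 1
  ext x
  simp only [← Finset.sum_mul, ← mul_assoc]
  congr 1
  have h1 : ∑ p : Fin m, ∑ q : Fin n, (Matrix.single q p (1 : ℂ) * reducedOperator x ^ k +
      (amplitudes x)ᴴ * ∑ a ∈ Finset.range k, reducedOperator x ^ a *
        (amplitudes x * Matrix.single q p (1 : ℂ)) * reducedOperator x ^ (k - 1 - a)) q p =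
      n * (reducedOperator x ^ k).trace + ∑ a ∈ Finset.range k,
        (reducedOperator x ^ (a + 1)).trace * (reducedOperator x ^ (k - 1 - a)).trace := by
    simp only [Matrix.add_apply, Finset.sum_add_distrib]
    congr 1
    · simp only [Matrix.single_mul_apply_same, one_mul]
      simp [Finset.mul_sum, Matrix.trace]
    · simp only [Matrix.mul_sum, Matrix.sum_apply]
      rw [Finset.sum_congr rfl fun p _ => Finset.sum_comm, Finset.sum_comm]
      refine Finset.sum_congr rfl fun a _ => ?_
      rw [← trace_mul_pow_amplitudes]
      simp only [Matrix.trace, Matrix.diag, Finset.sum_mul, Finset.mul_sum]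
      refine Finset.sum_congr rfl fun p _ => Finset.sum_congr rfl fun q _ => ?_
      have : (amplitudes x)ᴴ * (reducedOperator x ^ a * (amplitudes x * Matrix.single q p (1 : ℂ)) *
          reducedOperator x ^ (k - 1 - a)) =
          ((amplitudes x)ᴴ * reducedOperator x ^ a * amplitudes x) * Matrix.single q p (1 : ℂ) *
          reducedOperator x ^ (k - 1 - a) := by simp only [Matrix.mul_assoc]
      rw [this, Matrix.mul_assoc, Matrix.mul_apply, Finset.sum_eq_single q]
      · simp
      · intro b _ hb
        rw [Matrix.single_mul_apply_of_ne _ _ _ _ _ hb.symm.symm, mul_zero]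
      · simp
  simp only [Finset.sum_add_distrib, ← Finset.sum_mul]
  rw [sum_mul_dbarPowerTraceProd, h1, loopTerm]
  simp only [powerTraceProd_cons, powerTrace]
  have h2 : ∀ a ∈ Finset.range k, (m : ℂ) ^ (a + 1) / n * (reducedOperator x ^ (a + 1)).trace *
      ((m : ℂ) ^ (k - 1 - a) / n * (reducedOperator x ^ (k - 1 - a)).trace *
        powerTraceProd l x) = (m : ℂ) ^ k / n ^ 2 * powerTraceProd l x *
          ((reducedOperator x ^ (a + 1)).trace * (reducedOperator x ^ (k - 1 - a)).trace) := by
    intro a ha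
    have : (m : ℂ) ^ k = m ^ (a + 1) * m ^ (k - 1 - a) := by
      rw [← pow_add]; congr 1; have := Finset.mem_range.1 ha; omega
    rw [this]; ring
  rw [Finset.sum_congr rfl h2, ← Finset.mul_sum]
  field_simp
  rw [pow_succ]
  ring

end TraceMoments

/-! ### From the Gaussian weight to the unit sphere. -/

section SphereMoments

open RandomStates Matrix

variable {m n : ℕ}

theorem reducedOperator_smul (r : ℝ) (x : Space 1 m n) :
    reducedOperator (r • x) = (r : ℂ) ^ 2 • reducedOperator x := by
  have : amplitudes (r • x) = (r : ℂ) • amplitudes x := by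
    ext a b
    simp [amplitudes]
  rw [reducedOperator, this, Matrix.conjTranspose_smul, Matrix.smul_mul, Matrix.mul_smul, smul_smul,
    reducedOperator]
  simp [sq]

theorem powerTrace_smul (r : ℝ) (k : ℕ) (x : Space 1 m n) :
    powerTrace k (r • x) = (r : ℂ) ^ (2 * k) * powerTrace k x := by
  rw [powerTrace, reducedOperator_smul, smul_pow, Matrix.trace_smul, ← pow_mul, powerTrace,
    smul_eq_mul]
  ring

theorem powerTraceProd_smul (r : ℝ) (l : List ℕ) (x : Space 1 m n) :
    powerTraceProd l (r • x) = (r : ℂ) ^ (2 * l.sum) * powerTraceProd l x := by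
  induction l with
  | nil => simp
  | cons k l ih =>
    rw [powerTraceProd_cons, powerTraceProd_cons, ih, powerTrace_smul, List.sum_cons]
    ring

theorem mergedProd_smul (r : ℝ) (k : ℕ) (l : List ℕ) (x : Space 1 m n) :
    mergedProd k l (r • x) = (r : ℂ) ^ (2 * (k + l.sum)) * mergedProd k l x := by
  induction l with
  | nil => simp [mergedProd]
  | cons q l ih =>
    rw [mergedProd, mergedProd, ih, powerTrace_smul, powerTrace_smul, powerTraceProd_smul,
      List.sum_cons]
    ring

theorem loopTerm_smul (r : ℝ) (k : ℕ) (l : List ℕ) (x : Space 1 m n) :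
    loopTerm k l (r • x) = (r : ℂ) ^ (2 * (k + l.sum)) * loopTerm k l x := by
  have h : ∀ a ∈ Finset.range k, powerTraceProd ((a + 1) :: (k - 1 - a) :: l) (r • x) =
      (r : ℂ) ^ (2 * (k + l.sum)) * powerTraceProd ((a + 1) :: (k - 1 - a) :: l) x := by
    intro a ha
    rw [powerTraceProd_smul, List.sum_cons, List.sum_cons]
    congr 3
    have := Finset.mem_range.1 ha
    omega
  rw [loopTerm, loopTerm, Finset.sum_congr rfl h, ← Finset.mul_sum, powerTraceProd_smul,
    mergedProd_smul, List.sum_cons]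
  ring

theorem continuous_reducedOperator : Continuous fun x : Space 1 m n => reducedOperator x := by
  have : Continuous fun x : Space 1 m n => amplitudes x :=
    continuous_matrix fun a b => by
      change Continuous fun x : Space 1 m n => x (0, a, b)
      fun_prop
  exact this.matrix_mul this.matrix_conjTranspose

theorem continuous_powerTrace (k : ℕ) : Continuous fun x : Space 1 m n => powerTrace k x :=
  continuous_const.mul (continuous_reducedOperator.pow k).matrix_trace

theorem continuous_powerTraceProd (l : List ℕ) :
    Continuous fun x : Space 1 m n => powerTraceProd l x := by
  induction l with
  | nil => exact continuous_const
  | cons k l ih =>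
    simp only [powerTraceProd_cons]
    exact (continuous_powerTrace k).mul ih

theorem continuous_mergedProd (k : ℕ) (l : List ℕ) :
    Continuous fun x : Space 1 m n => mergedProd k l x := by
  induction l with
  | nil => exact continuous_const
  | cons r l ih =>
    exact ((continuous_const.mul (continuous_powerTrace (k + r))).mul
      (continuous_powerTraceProd l)).add ((continuous_powerTrace r).mul ih)

instance isProbabilityMeasure_uniformUnitVector [NeZero m] [NeZero n] :
    IsProbabilityMeasure (uniformUnitVector 1 m n) := by
  have : Nonempty (Fin 1 × Fin m × Fin n) := ⟨(0, 0, 0)⟩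
  refine ⟨?_⟩
  rw [uniformUnitVector, Measure.smul_apply, smul_eq_mul]
  refine ENNReal.inv_mul_cancel ?_ (measure_ne_top _ _)
  rw [Ne, Measure.measure_univ_eq_zero]
  exact Measure.toSphere_ne_zero _

theorem integrable_sphere [NeZero m] [NeZero n] {f : Space 1 m n → ℂ} (hf : Continuous f) :
    Integrable (fun u : UnitVector 1 m n => f u.1) (uniformUnitVector 1 m n) := by
  have hc : Continuous fun u : UnitVector 1 m n => f u.1 := hf.comp continuous_subtype_val
  obtain ⟨C, hC⟩ := (isCompact_range hc).isBounded.exists_norm_le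
  exact Integrable.of_bound hc.aestronglyMeasurable C
    (Eventually.of_forall fun u => hC _ (Set.mem_range_self u))

/-- The mean of a product of power traces over the unit sphere. -/
noncomputable def sphereMoment (m n : ℕ) (l : List ℕ) : ℂ :=
  ∫ u : UnitVector 1 m n, powerTraceProd l u.1 ∂uniformUnitVector 1 m n

/-- The two sides of the Gaussian equation are homogeneous of degrees `2(k + s + 1)` and `2(k + s)`
with `s = l.sum`. The quotient of their radial factors is `Γ(mn + k + s + 1) / Γ(mn + k + s) = mn +
k + s`; division by `mn` leaves the prefactor. -/
theorem sphere_loop_equation [NeZero m] [NeZero n] (k : ℕ) (l : List ℕ) :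
    (1 + ((k + l.sum : ℕ) : ℂ) / (m * n)) * sphereMoment m n ((k + 1) :: l) =
      sphereMoment m n (k :: l) +
        (∑ a ∈ Finset.range k, sphereMoment m n ((a + 1) :: (k - 1 - a) :: l)) +
        ((n : ℂ) ^ 2)⁻¹ *
          ∫ u : UnitVector 1 m n, mergedProd k l u.1 ∂uniformUnitVector 1 m n := by
  have hm : (m : ℂ) ≠ 0 := NeZero.ne _
  have hn : (n : ℂ) ≠ 0 := NeZero.ne _
  have hmn : 0 < m * n := Nat.mul_pos (NeZero.pos m) (NeZero.pos n)
  have : Nonempty (Fin 1 × Fin m × Fin n) := ⟨(0, 0, 0)⟩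
  have h := integral_loop_equation (m := m) (n := n) k l
  rw [integral_mul_gaussWeight_eq_toSphere (d := k + l.sum + 1), integral_mul_gaussWeight_eq_toSphere
    (d := k + l.sum)] at h
  rotate_left
  · exact fun r x _ => loopTerm_smul r k l x
  · intro r x _
    rw [powerTraceProd_smul, List.sum_cons]
    congr 3; omega
  have hcard : Fintype.card (Fin 1 × Fin m × Fin n) = m * n := by simp
  have hpos : (0 : ℝ) < (m * n : ℕ) + (k + l.sum : ℕ) := by positivity
  rw [hcard, Nat.cast_add (k + l.sum) 1, Nat.cast_one, ← add_assoc, Real.Gamma_add_one hpos.ne'] at h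
  have hΓ : ((Real.Gamma ((m * n : ℕ) + (k + l.sum : ℕ)) : ℝ) : ℂ) ≠ 0 := by
    exact_mod_cast (Real.Gamma_pos_of_pos hpos).ne'
  have h' : (1 + ((k + l.sum : ℕ) : ℂ) / (m * n)) *
      (∫ u, powerTraceProd ((k + 1) :: l) u.1 ∂(volume : Measure (Space 1 m n)).toSphere) =
      ∫ u, loopTerm k l u.1 ∂(volume : Measure (Space 1 m n)).toSphere := by
    rw [Complex.ofReal_div, Complex.ofReal_div, Complex.ofReal_mul] at h
    generalize ((Real.Gamma ((m * n : ℕ) + (k + l.sum : ℕ)) : ℝ) : ℂ) = Γ at h hΓ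
    generalize k + l.sum = s at h
    field_simp
    refine mul_right_cancel₀ hΓ ?_
    push_cast at h ⊢
    linear_combination 2 * h
  have h'' : (1 + ((k + l.sum : ℕ) : ℂ) / (m * n)) * sphereMoment m n ((k + 1) :: l) =
      ∫ u : UnitVector 1 m n, loopTerm k l u.1 ∂uniformUnitVector 1 m n := by
    rw [sphereMoment, uniformUnitVector, integral_smul_measure, integral_smul_measure, ← h',
      mul_smul_comm]
  rw [h'']
  have i1 := integrable_sphere (continuous_powerTraceProd (m := m) (n := n) (k :: l))
  have i2 := fun a => integrable_sphere
    (continuous_powerTraceProd (m := m) (n := n) ((a + 1) :: (k - 1 - a) :: l))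
  have i4 : Integrable (fun u : UnitVector 1 m n => ∑ a ∈ Finset.range k,
      powerTraceProd ((a + 1) :: (k - 1 - a) :: l) u.1) (uniformUnitVector 1 m n) :=
    integrable_finsetSum _ fun a _ => i2 a
  have i5 : Integrable (fun u : UnitVector 1 m n => powerTraceProd (k :: l) u.1 +
      ∑ a ∈ Finset.range k, powerTraceProd ((a + 1) :: (k - 1 - a) :: l) u.1)
      (uniformUnitVector 1 m n) := i1.add i4
  have i3 := integrable_sphere (continuous_mergedProd (m := m) (n := n) k l)
  simp only [loopTerm]
  rw [integral_add i5 (i3.const_mul _), integral_add i1 i4,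
    integral_finsetSum _ fun a _ => i2 a, integral_const_mul]
  rfl

theorem sphereMoment_perm {l l' : List ℕ} (h : l.Perm l') :
    sphereMoment m n l = sphereMoment m n l' := by
  simp only [sphereMoment, powerTraceProd]
  congr 1
  ext u
  exact (h.map _).prod_eq

end SphereMoments

/-! ### Factorization of moments up to `O(n⁻²)`. -/

section Asymptotics

open RandomStates Asymptotics

/-- The moments of the limit law, defined by their recursion (except that the moment of order `0`
is replaced by the rate). -/
noncomputable def loopMoment (c : ℝ) : ℕ → ℝ
  | 0 => c
  | k + 1 => loopMoment c k + ∑ a : Fin k, loopMoment c (a + 1) * loopMoment c (k - 1 - a)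

theorem loopMoment_zero (c : ℝ) : loopMoment c 0 = c := by rw [loopMoment]

theorem loopMoment_succ (c : ℝ) (k : ℕ) : loopMoment c (k + 1) = loopMoment c k +
    ∑ a ∈ Finset.range k, loopMoment c (a + 1) * loopMoment c (k - 1 - a) := by
  rw [loopMoment, Finset.sum_range fun a => loopMoment c (a + 1) * loopMoment c (k - 1 - a)]

theorem continuous_loopMoment (k : ℕ) : Continuous fun c => loopMoment c k := by
  induction k using Nat.strong_induction_on with
  | _ k ih =>
    cases k with
    | zero => simp only [loopMoment_zero]; exact continuous_id
    | succ k =>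
      have h : (fun c => loopMoment c (k + 1)) = _ := funext fun c => loopMoment_succ c k
      rw [h]
      refine (ih k (by omega)).add (continuous_finsetSum _ fun a ha => ?_)
      have := Finset.mem_range.1 ha
      exact (ih _ (by omega)).mul (ih _ (by omega))

variable {c : ℝ} {m : ℕ+ → ℕ+}

theorem isBigO_one_loopMoment_prod
    (hm : Tendsto (fun n : ℕ+ => ((m n : ℕ) : ℝ) / ((n : ℕ) : ℝ)) atTop (𝓝 c)) (l : List ℕ) :
    (fun n : ℕ+ => (((l.map (loopMoment (((m n : ℕ) : ℝ) / ((n : ℕ) : ℝ)))).prod : ℝ) : ℂ))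
      =O[atTop] (fun _ => (1 : ℝ)) := by
  have hc : Continuous fun c => (((l.map (loopMoment c)).prod : ℝ) : ℂ) := by
    refine Complex.continuous_ofReal.comp ?_
    exact continuous_list_prod l fun k _ => continuous_loopMoment k
  exact (hc.continuousAt.tendsto.comp hm).isBigO_one ℝ

/-- `1 / (mn) = (m / n)⁻¹ n⁻²`, and `(m / n)⁻¹` converges because `c ≠ 0`. -/
theorem isBigO_inv_mul (hc : 0 < c)
    (hm : Tendsto (fun n : ℕ+ => ((m n : ℕ) : ℝ) / ((n : ℕ) : ℝ)) atTop (𝓝 c)) (d : ℂ) :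
    (fun n : ℕ+ => d / (((m n : ℕ) : ℂ) * ((n : ℕ) : ℂ))) =O[atTop]
      (fun n : ℕ+ => (((n : ℕ) : ℝ) ^ 2)⁻¹) := by
  have h1 : (fun n : ℕ+ => d * (((((m n : ℕ) : ℝ) / ((n : ℕ) : ℝ))⁻¹ : ℝ) : ℂ)) =O[atTop]
      (fun _ => (1 : ℝ)) := by
    exact (((Complex.continuous_ofReal.tendsto _).comp (hm.inv₀ hc.ne')).const_mul d).isBigO_one ℝ
  have h2 : (fun n : ℕ+ => (((((n : ℕ) : ℝ) ^ 2)⁻¹ : ℝ) : ℂ)) =O[atTop]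
      (fun n : ℕ+ => (((n : ℕ) : ℝ) ^ 2)⁻¹) :=
    IsBigO.of_bound 1 (Eventually.of_forall fun n => by rw [Complex.norm_real, one_mul])
  refine ((h1.mul h2).congr (fun n => ?_) (fun n => by rw [one_mul]))
  have : ((n : ℕ) : ℂ) ≠ 0 := by exact_mod_cast n.ne_zero
  have : ((m n : ℕ) : ℂ) ≠ 0 := by exact_mod_cast (m n).ne_zero
  push_cast
  field_simp

/-- The list `p` accumulates the factors already passed by the recursion of `mergedProd`. Merging
preserves the total degree, so boundedness in that single degree suffices. -/
theorem isBigO_integral_mergedProd (k : ℕ) (l p : List ℕ)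
    (h : ∀ l' : List ℕ, l'.sum = p.sum + k + l.sum →
      (fun n : ℕ+ => sphereMoment (m n) n l') =O[atTop] (fun _ => (1 : ℝ))) :
    (fun n : ℕ+ => ∫ u : UnitVector 1 (m n) n, powerTraceProd p u.1 * mergedProd k l u.1
      ∂uniformUnitVector 1 (m n) n) =O[atTop] (fun _ => (1 : ℝ)) := by
  induction l generalizing p with
  | nil =>
    simp only [mergedProd, mul_zero, integral_zero]
    exact isBigO_zero _ _
  | cons r l ih =>
    have h1 := ih (r :: p) (fun l' hl' => h l' (by rw [hl']; simp; ring))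
    have h2 := (h ((k + r) :: (p ++ l)) (by simp; ring)).const_mul_left (r : ℂ)
    refine (h2.add h1).congr_left fun n => ?_
    rw [sphereMoment, ← integral_const_mul, ← integral_add]
    · congr 1
      ext u
      rw [mergedProd, powerTraceProd_cons, powerTraceProd_cons]
      have : powerTraceProd (p ++ l) u.1 = powerTraceProd p u.1 * powerTraceProd l u.1 := by
        simp [powerTraceProd]
      rw [this]
      ring
    · exact (integrable_sphere (continuous_powerTraceProd _)).const_mul _
    · exact integrable_sphere ((continuous_powerTraceProd _).mul (continuous_mergedProd _ _))

theorem powerTrace_zero {m n : ℕ} (x : Space 1 m n) :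
    powerTrace 0 x = ((((m : ℝ) / n : ℝ)) : ℂ) := by
  simp [powerTrace, div_eq_inv_mul]

/-- Asymptotic factorization of the moments of power traces. -/
theorem isBigO_sphereMoment_sub (hc : 0 < c)
    (hm : Tendsto (fun n : ℕ+ => ((m n : ℕ) : ℝ) / ((n : ℕ) : ℝ)) atTop (𝓝 c)) (l : List ℕ) :
    (fun n : ℕ+ => sphereMoment (m n) n l -
      (((l.map (loopMoment (((m n : ℕ) : ℝ) / ((n : ℕ) : ℝ)))).prod : ℝ) : ℂ))
      =O[atTop] (fun n : ℕ+ => (((n : ℕ) : ℝ) ^ 2)⁻¹) := by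
  -- Induction on the total degree: every term on the right of the loop equation has degree one
  -- less. In degree `0` all factors are `T 0 = m / n`, and the factorization is exact.
  induction hd : l.sum generalizing l with
  | zero =>
    refine (isBigO_zero _ _).congr_left fun n => ?_
    symm
    rw [sub_eq_zero]
    have : ∀ u : UnitVector 1 (m n) n, powerTraceProd l u.1 =
        (((l.map (loopMoment (((m n : ℕ) : ℝ) / ((n : ℕ) : ℝ)))).prod : ℝ) : ℂ) := by
      intro u
      induction l with
      | nil => simp
      | cons r l ih =>
        obtain ⟨rfl, hl⟩ : r = 0 ∧ l.sum = 0 := by simpa using hd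
        rw [powerTraceProd_cons, ih hl, powerTrace_zero, List.map_cons, List.prod_cons,
          loopMoment_zero, Complex.ofReal_mul]
    simp [sphereMoment, this]
  | succ d ih =>
    have hO1 : ∀ l' : List ℕ, l'.sum = d →
        (fun n : ℕ+ => sphereMoment (m n) n l') =O[atTop] (fun _ => (1 : ℝ)) := by
      intro l' hl'
      have h0 : (fun n : ℕ+ => (((n : ℕ) : ℝ) ^ 2)⁻¹) =O[atTop] (fun _ => (1 : ℝ)) := by
        refine IsBigO.of_bound 1 (Eventually.of_forall fun n => ?_)
        have : (1 : ℝ) ≤ ((n : ℕ) : ℝ) ^ 2 := by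
          have : (1 : ℝ) ≤ ((n : ℕ) : ℝ) := by exact_mod_cast n.pos
          nlinarith
        rw [Real.norm_of_nonneg (by positivity)]
        simpa using inv_le_one_of_one_le₀ this
      refine (((ih l' hl').trans h0).add (isBigO_one_loopMoment_prod hm l')).congr_left fun n => ?_
      ring
    -- A positive entry, moved to the front by symmetry, supplies the factor `T (k+1)` to which the
    -- loop equation applies.
    obtain ⟨r, hr, hr0⟩ : ∃ r ∈ l, r ≠ 0 := by
      by_contra! hcon
      have : l.sum = 0 := List.sum_eq_zero hcon
      omega
    obtain ⟨k, rfl⟩ := Nat.exists_eq_succ_of_ne_zero hr0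
    have hperm := List.perm_cons_erase hr
    set l' := l.erase k.succ
    have hsum : k + l'.sum = d := by
      have := hperm.sum_eq
      rw [List.sum_cons] at this
      omega
    have e1 := ih (k :: l') (by simpa using hsum)
    have e2 : ∀ a ∈ Finset.range k, _ := fun a ha => ih ((a + 1) :: (k - 1 - a) :: l') (by
      have := Finset.mem_range.1 ha
      simp only [List.sum_cons]
      omega)
    have e3 := isBigO_integral_mergedProd (m := m) k l' [] (fun l'' h => hO1 l'' (by
      rw [h]; simpa using hsum))
    have e3' : (fun n : ℕ+ => (((n : ℕ) : ℂ) ^ 2)⁻¹ * ∫ u : UnitVector 1 (m n) n,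
        powerTraceProd [] u.1 * mergedProd k l' u.1 ∂uniformUnitVector 1 (m n) n) =O[atTop]
        (fun n : ℕ+ => (((n : ℕ) : ℝ) ^ 2)⁻¹) := by
      have h2 : (fun n : ℕ+ => (((n : ℕ) : ℂ) ^ 2)⁻¹) =O[atTop]
          (fun n : ℕ+ => (((n : ℕ) : ℝ) ^ 2)⁻¹) :=
        IsBigO.of_bound 1 (Eventually.of_forall fun n => by simp)
      simpa using h2.mul e3
    -- The candidate product satisfies the recursion without the prefactor `1 + (k + s) / (mn)`;
    -- `e4` bounds the resulting discrepancy.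
    have e4 := (isBigO_inv_mul hc hm ((k + l'.sum : ℕ) : ℂ)).mul
      (isBigO_one_loopMoment_prod hm ((k + 1) :: l'))
    simp only [mul_one] at e4
    have e5 := ((e1.add (IsBigO.sum e2)).add e3').sub e4
    have e6 : (fun n : ℕ+ => (1 + ((k + l'.sum : ℕ) : ℂ) / (((m n : ℕ) : ℂ) * ((n : ℕ) : ℂ)))⁻¹)
        =O[atTop] (fun _ => (1 : ℝ)) := by
      refine IsBigO.of_bound 1 (Eventually.of_forall fun n => ?_)
      have : (1 + ((k + l'.sum : ℕ) : ℂ) / (((m n : ℕ) : ℂ) * ((n : ℕ) : ℂ))) =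
          ((1 + ((k + l'.sum : ℕ) : ℝ) / (((m n : ℕ) : ℝ) * ((n : ℕ) : ℝ)) : ℝ) : ℂ) := by
        generalize k + l'.sum = s
        simp
      rw [this, norm_inv, Complex.norm_real, Real.norm_of_nonneg (by positivity), norm_one, mul_one]
      refine inv_le_one_of_one_le₀ ?_
      have : 0 ≤ ((k + l'.sum : ℕ) : ℝ) / (((m n : ℕ) : ℝ) * ((n : ℕ) : ℝ)) := by positivity
      linarith
    have e7 := e6.mul e5
    simp only [one_mul] at e7
    refine e7.congr_left fun n => ?_
    have hne : (1 + ((k + l'.sum : ℕ) : ℂ) / (((m n : ℕ) : ℂ) * ((n : ℕ) : ℂ))) ≠ 0 := by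
      have : (1 + ((k + l'.sum : ℕ) : ℂ) / (((m n : ℕ) : ℂ) * ((n : ℕ) : ℂ))) =
          ((1 + ((k + l'.sum : ℕ) : ℝ) / (((m n : ℕ) : ℝ) * ((n : ℕ) : ℝ)) : ℝ) : ℂ) := by
        generalize k + l'.sum = s
        simp
      rw [this]
      have : (0 : ℝ) < 1 + ((k + l'.sum : ℕ) : ℝ) / (((m n : ℕ) : ℝ) * ((n : ℕ) : ℝ)) := by
        positivity
      exact_mod_cast this.ne'
    have hloop := sphere_loop_equation (m := m n) (n := n) k l'
    rw [sphereMoment_perm hperm, (hperm.map _).prod_eq, inv_mul_eq_iff_eq_mul₀ hne, mul_sub, hloop]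
    simp only [List.map_cons, List.prod_cons, loopMoment_succ _ k, Finset.sum_apply, Finset.sum_sub_distrib,
      powerTraceProd_nil, one_mul, Nat.succ_eq_add_one]
    generalize k + l'.sum = s
    push_cast
    simp only [add_mul, Finset.sum_mul, mul_assoc]
    ring

end Asymptotics

/-! ### Almost sure convergence of the power traces. -/

section AlmostSure

open RandomStates Matrix Asymptotics

theorem isHermitian_reducedOperator {m n : ℕ} (x : Space 1 m n) : (reducedOperator x).IsHermitian :=
  Matrix.isHermitian_mul_conjTranspose_self _

theorem powerTrace_eq_re {m n : ℕ} (k : ℕ) (x : Space 1 m n) :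
    powerTrace k x = ((powerTrace k x).re : ℂ) := by
  refine (Complex.conj_eq_iff_re.1 ?_).symm
  have h : star ((reducedOperator x ^ k).trace) = (reducedOperator x ^ k).trace := by
    rw [← Matrix.trace_conjTranspose, ((isHermitian_reducedOperator x).pow k).eq]
  rw [powerTrace, map_mul]
  congr 1
  · simp

/-- Nonnegative random variables whose means are summable converge to `0` almost surely. -/
theorem ae_tendsto_zero_of_summable_integral {Ω : Type*} [MeasurableSpace Ω] {P : Measure Ω}
    {f : ℕ → Ω → ℝ} (hf : ∀ n, Integrable (f n) P) (h0 : ∀ n ω, 0 ≤ f n ω)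
    (hs : Summable fun n => ∫ ω, f n ω ∂P) : ∀ᵐ ω ∂P, Tendsto (fun n => f n ω) atTop (𝓝 0) := by
  have hm : ∀ n, AEMeasurable (fun ω => ENNReal.ofReal (f n ω)) P := fun n =>
    (hf n).aemeasurable.ennreal_ofReal
  have h1 : ∫⁻ ω, ∑' n, ENNReal.ofReal (f n ω) ∂P ≠ ⊤ := by
    rw [lintegral_tsum hm]
    simp_rw [← ofReal_integral_eq_lintegral_ofReal (hf _) (Eventually.of_forall (h0 _))]
    exact hs.tsum_ofReal_ne_top
  filter_upwards [ae_lt_top' (AEMeasurable.tsum hm) h1] with ω hω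
  have := ENNReal.tendsto_atTop_zero_of_tsum_ne_top hω.ne
  have h2 := (ENNReal.tendsto_toReal ENNReal.zero_ne_top).comp this
  simpa [Function.comp_def, ENNReal.toReal_ofReal (h0 _ _)] using h2

theorem tendsto_comp_succPNat {α : Type*} {F : ℕ+ → α} {l : Filter α}
    (h : Tendsto (fun j : ℕ => F j.succPNat) atTop l) : Tendsto F atTop l := by
  have : map Nat.succPNat atTop = atTop := OrderIso.pnatIsoNat.symm.map_atTop
  rw [← this]
  exact h

theorem tendsto_succPNat : Tendsto Nat.succPNat atTop atTop :=
  OrderIso.pnatIsoNat.symm.tendsto_atTop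

theorem ae_tendsto_powerTrace {Ω : Type*} [MeasurableSpace Ω] (P : Measure Ω)
    [IsProbabilityMeasure P] {c : ℝ} (hc : 0 < c) {m : ℕ+ → ℕ+}
    (hm : Tendsto (fun n : ℕ+ => ((m n : ℕ) : ℝ) / ((n : ℕ) : ℝ)) atTop (𝓝 c))
    (v : (n : ℕ+) → Ω → UnitVector 1 (m n) n)
    (hv : ∀ n : ℕ+, HasLaw (v n) (uniformUnitVector 1 (m n) n) P) (k : ℕ) :
    ∀ᵐ ω ∂P, Tendsto (fun n : ℕ+ => (powerTrace k (v n ω).1).re) atTop (𝓝 (loopMoment c k)) := by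
  -- Centring at the moment of rate `m n / n` instead of `c`: no speed is assumed in `m n / n → c`.
  set a : ℕ+ → ℝ := fun n => loopMoment (((m n : ℕ) : ℝ) / ((n : ℕ) : ℝ)) k with ha
  have hac : Tendsto a atTop (𝓝 (loopMoment c k)) :=
    ((continuous_loopMoment k).tendsto c).comp hm
  set g : (n : ℕ+) → UnitVector 1 (m n) n → ℝ := fun n u => ((powerTrace k u.1).re - a n) ^ 2 with hg
  have hgc : ∀ n, Continuous (g n) := fun n =>
    ((Complex.continuous_re.comp ((continuous_powerTrace k).comp continuous_subtype_val)).sub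
      continuous_const).pow 2
  have hgi : ∀ n, Integrable (g n) (uniformUnitVector 1 (m n) n) := by
    intro n
    obtain ⟨C, hC⟩ := (isCompact_range (hgc n)).isBounded.exists_norm_le
    exact Integrable.of_bound (hgc n).aestronglyMeasurable C
      (Eventually.of_forall fun u => hC _ (Set.mem_range_self u))
  have hmean : ∀ n : ℕ+, ((∫ u, g n u ∂uniformUnitVector 1 (m n) n : ℝ) : ℂ) =
      sphereMoment (m n) n [k, k] - 2 * a n * sphereMoment (m n) n [k] + a n ^ 2 := by
    intro n
    have hi (l : List ℕ) := integrable_sphere (continuous_powerTraceProd (m := m n) (n := n) l)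
    rw [← integral_complex_ofReal, sphereMoment, sphereMoment, ← integral_const_mul,
      ← integral_sub (hi _) ((hi _).const_mul _)]
    have : ((a n : ℂ)) ^ 2 = ∫ _ : UnitVector 1 (m n) n, ((a n : ℂ)) ^ 2
        ∂uniformUnitVector 1 (m n) n := by simp
    have hsub : Integrable (fun u : UnitVector 1 (m n) n => powerTraceProd [k, k] u.1 -
        2 * a n * powerTraceProd [k] u.1) (uniformUnitVector 1 (m n) n) :=
      (hi _).sub ((hi _).const_mul _)
    rw [this, ← integral_add hsub (integrable_const _)]
    congr 1
    ext u
    simp only [hg, powerTraceProd_cons, powerTraceProd_nil]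
    push_cast
    rw [← powerTrace_eq_re]
    ring
  -- `E (T - a)² = (E T² - a²) - 2a (E T - a)`, and factorization makes both brackets `O(n⁻²)`.
  have hO : (fun n => ∫ u, g n u ∂uniformUnitVector 1 (m n) n) =O[atTop]
      (fun n : ℕ+ => (((n : ℕ) : ℝ) ^ 2)⁻¹) := by
    have h1 := isBigO_sphereMoment_sub hc hm [k, k]
    have h2 := ((isBigO_one_loopMoment_prod hm [k]).mul
      (isBigO_sphereMoment_sub hc hm [k])).const_mul_left 2
    simp only [one_mul] at h2
    refine IsBigO.of_norm_left (((h1.sub h2).norm_left).congr_left fun n => ?_)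
    rw [← Complex.norm_real, hmean]
    congr 1
    simp only [List.map_cons, List.map_nil, List.prod_cons, List.prod_nil, mul_one, ha]
    push_cast
    ring
  have hsum : Summable fun j : ℕ => ∫ ω, g j.succPNat (v j.succPNat ω) ∂P := by
    have h1 : ∀ n : ℕ+, ∫ ω, g n (v n ω) ∂P = ∫ u, g n u ∂uniformUnitVector 1 (m n) n := fun n =>
      (hv n).integral_comp (hgc n).aestronglyMeasurable
    simp_rw [h1]
    refine summable_of_isBigO_nat ?_ (hO.comp_tendsto tendsto_succPNat)
    have := (summable_nat_add_iff 1).2 (Real.summable_nat_pow_inv.2 (one_lt_two))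
    simpa [Function.comp_def] using this
  have hint : ∀ j : ℕ, Integrable (fun ω => g j.succPNat (v j.succPNat ω)) P := fun j =>
    (integrable_map_measure (hgc _).aestronglyMeasurable (hv _).aemeasurable).1
      ((hv _).map_eq ▸ hgi _)
  filter_upwards [ae_tendsto_zero_of_summable_integral hint (fun _ _ => sq_nonneg _) hsum]
    with ω hω
  have h2 : Tendsto (fun n : ℕ+ => g n (v n ω)) atTop (𝓝 0) := tendsto_comp_succPNat hω
  have h3 : Tendsto (fun n : ℕ+ => (powerTrace k (v n ω).1).re - a n) atTop (𝓝 0) := by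
    have := (Real.continuous_sqrt.tendsto 0).comp h2
    simp only [Function.comp_def, hg, Real.sqrt_sq_eq_abs, Real.sqrt_zero] at this
    exact (tendsto_zero_iff_abs_tendsto_zero _).2 this
  simpa using h3.add hac

end AlmostSure

/-! ### Moments of the partial transpose in terms of power traces. -/

section PartialTransposeMoments

open RandomStates Matrix
open scoped Kronecker

theorem Matrix.IsHermitian.trace_pow_eq_sum_eigenvalues {ι : Type*} [Fintype ι] [DecidableEq ι]
    {A : Matrix ι ι ℂ} (hA : A.IsHermitian) (p : ℕ) :
    (A ^ p).trace = ((∑ i, hA.eigenvalues i ^ p : ℝ) : ℂ) := by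
  conv_lhs => rw [hA.spectral_theorem, ← map_pow, Unitary.conjStarAlgAut_apply]
  rw [Matrix.trace_mul_comm, ← mul_assoc, Unitary.coe_star_mul_self, one_mul, Matrix.diagonal_pow,
    Matrix.trace_diagonal]
  simp

theorem integral_empiricalDistribution {ι : Type} [Fintype ι] [DecidableEq ι] [Nonempty ι]
    (A : Matrix ι ι ℂ) (hA : A.IsHermitian) (f : ℝ → ℝ) :
    ∫ x, f x ∂(empiricalDistribution A hA : Measure ℝ) =
      (Fintype.card ι : ℝ)⁻¹ * ∑ i, f (hA.eigenvalues i) := by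
  change ∫ x, f x ∂((Fintype.card ι : ENNReal)⁻¹ • ∑ i : ι, Measure.dirac (hA.eigenvalues i)) = _
  rw [integral_smul_measure, integral_finsetSum_measure fun i _ => integrable_dirac (by simp)]
  simp

theorem integrable_empiricalDistribution {ι : Type} [Fintype ι] [DecidableEq ι] [Nonempty ι]
    (A : Matrix ι ι ℂ) (hA : A.IsHermitian) (f : ℝ → ℝ) :
    Integrable f (empiricalDistribution A hA : Measure ℝ) := by
  change Integrable f ((Fintype.card ι : ENNReal)⁻¹ • ∑ i : ι, Measure.dirac (hA.eigenvalues i))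
  exact Integrable.smul_measure (integrable_finsetSum_measure.2 fun i _ =>
    integrable_dirac (by simp)) (by simp)

theorem integral_pow_empiricalDistribution {ι : Type} [Fintype ι] [DecidableEq ι] [Nonempty ι]
    (A : Matrix ι ι ℂ) (hA : A.IsHermitian) (p : ℕ) :
    ((∫ x, x ^ p ∂(empiricalDistribution A hA : Measure ℝ) : ℝ) : ℂ) =
      (Fintype.card ι : ℂ)⁻¹ * (A ^ p).trace := by
  rw [integral_empiricalDistribution A hA, hA.trace_pow_eq_sum_eigenvalues]
  push_cast
  rfl

variable {m n : ℕ}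

theorem partialTranspose_inducedState_apply (v : UnitVector 1 m n) (i j : Fin m × Fin n) :
    partialTranspose (inducedState v) i j =
      amplitudes v.1 i.1 j.2 * star (amplitudes v.1 j.1 i.2) := by
  simp [partialTranspose, inducedState, traceEnv, pureState, amplitudes]

/-- In the product the sum over the intermediate index of `ℂ^n` forms `M Mᴴ`, and that over `ℂ^m`
forms `Mᴴ M`; the two sums are independent. -/
theorem partialTranspose_inducedState_mul_self (v : UnitVector 1 m n) :
    partialTranspose (inducedState v) * partialTranspose (inducedState v) =
      reducedOperator v.1 ⊗ₖ ((amplitudes v.1)ᴴ * amplitudes v.1) := by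
  ext i j
  simp only [Matrix.mul_apply, partialTranspose_inducedState_apply, Matrix.kroneckerMap_apply,
    reducedOperator, Matrix.conjTranspose_apply]
  rw [Fintype.sum_prod_type, Finset.sum_mul_sum, Finset.sum_comm]
  refine Finset.sum_congr rfl fun b _ => Finset.sum_congr rfl fun a _ => ?_
  ring

theorem Matrix.kronecker_pow {α β R : Type*} [Fintype α] [Fintype β] [DecidableEq α]
    [DecidableEq β] [CommSemiring R] (A : Matrix α α R) (B : Matrix β β R) (k : ℕ) :
    (A ⊗ₖ B) ^ k = (A ^ k) ⊗ₖ (B ^ k) := by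
  induction k with
  | zero => simp
  | succ k ih => rw [pow_succ, ih, ← Matrix.mul_kronecker_mul, pow_succ, pow_succ]

theorem mul_pow_conjTranspose_mul (x : Space 1 m n) (k : ℕ) :
    amplitudes x * ((amplitudes x)ᴴ * amplitudes x) ^ k =
      reducedOperator x ^ k * amplitudes x := by
  induction k with
  | zero => simp
  | succ k ih =>
    rw [pow_succ, ← Matrix.mul_assoc, ih, pow_succ]
    simp only [Matrix.mul_assoc, reducedOperator]

theorem trace_pow_conjTranspose_mul (x : Space 1 m n) {k : ℕ} (hk : k ≠ 0) :
    (((amplitudes x)ᴴ * amplitudes x) ^ k).trace = (reducedOperator x ^ k).trace := by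
  obtain ⟨k, rfl⟩ := Nat.exists_eq_succ_of_ne_zero hk
  rw [Nat.succ_eq_add_one, pow_succ', Matrix.mul_assoc, mul_pow_conjTranspose_mul,
    Matrix.trace_mul_comm, Matrix.mul_assoc, ← reducedOperator, pow_succ]

/-- For `k = 0` this fails unless `m = n`: the two Kronecker factors have traces `m` and `n`. -/
theorem trace_partialTranspose_pow_even (v : UnitVector 1 m n) {k : ℕ} (hk : k ≠ 0) :
    (partialTranspose (inducedState v) ^ (2 * k)).trace = (reducedOperator v.1 ^ k).trace ^ 2 := by
  rw [pow_mul, sq (partialTranspose _), partialTranspose_inducedState_mul_self,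
    Matrix.kronecker_pow, Matrix.trace_kronecker, trace_pow_conjTranspose_mul _ hk, sq]

/-- The extra factor `ρ^Γ` links the two Kronecker factors into the single trace `tr (W ^ k M (Mᴴ M)
^ k Mᴴ)`. -/
theorem trace_partialTranspose_pow_odd (v : UnitVector 1 m n) (k : ℕ) :
    (partialTranspose (inducedState v) ^ (2 * k + 1)).trace =
      (reducedOperator v.1 ^ (2 * k + 1)).trace := by
  rw [pow_succ, pow_mul, sq (partialTranspose _), partialTranspose_inducedState_mul_self,
    Matrix.kronecker_pow]
  have h : (reducedOperator v.1 ^ (2 * k + 1)).trace = (reducedOperator v.1 ^ k *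
      ((amplitudes v.1 * ((amplitudes v.1)ᴴ * amplitudes v.1) ^ k) * (amplitudes v.1)ᴴ)).trace := by
    rw [mul_pow_conjTranspose_mul, Matrix.mul_assoc _ (amplitudes v.1), ← reducedOperator,
      ← pow_succ, ← pow_add]
    congr 2; omega
  rw [h]
  simp only [Matrix.trace, Matrix.diag, Matrix.mul_apply, Fintype.sum_prod_type,
    partialTranspose_inducedState_apply, Matrix.kroneckerMap_apply, Finset.sum_mul, Finset.mul_sum,
    Matrix.conjTranspose_apply]
  refine Finset.sum_congr rfl fun a _ => ?_
  rw [Finset.sum_comm]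
  refine Finset.sum_congr rfl fun a' _ => ?_
  rw [Finset.sum_comm]
  refine Finset.sum_congr rfl fun b _ => Finset.sum_congr rfl fun b' _ => ?_
  ring

theorem integral_pow_even_empiricalPT [NeZero m] [NeZero n] (v : UnitVector 1 m n) {k : ℕ}
    (hk : k ≠ 0) : ∫ x, x ^ (2 * k) ∂(empiricalPT v : Measure ℝ) =
      ((m : ℝ) / n)⁻¹ * (powerTrace k v.1).re ^ 2 := by
  have hm : (m : ℂ) ≠ 0 := NeZero.ne _
  have hn : (n : ℂ) ≠ 0 := NeZero.ne _
  apply Complex.ofReal_injective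
  rw [empiricalPT, integral_pow_empiricalDistribution, rescaledPT, smul_pow, Matrix.trace_smul,
    trace_partialTranspose_pow_even v hk, Complex.ofReal_mul, Complex.ofReal_pow,
    ← powerTrace_eq_re, powerTrace, mul_comm 2 k, pow_mul]
  simp
  field_simp

theorem integral_pow_odd_empiricalPT [NeZero m] [NeZero n] (v : UnitVector 1 m n) (k : ℕ) :
    ∫ x, x ^ (2 * k + 1) ∂(empiricalPT v : Measure ℝ) =
      (m : ℝ)⁻¹ * (powerTrace (2 * k + 1) v.1).re := by
  have hm : (m : ℂ) ≠ 0 := NeZero.ne _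
  have hn : (n : ℂ) ≠ 0 := NeZero.ne _
  apply Complex.ofReal_injective
  rw [empiricalPT, integral_pow_empiricalDistribution, rescaledPT, smul_pow, Matrix.trace_smul,
    trace_partialTranspose_pow_odd v, Complex.ofReal_mul,
    ← powerTrace_eq_re, powerTrace]
  simp
  field_simp

end PartialTransposeMoments

/-! ### Semicircle moments and the recursion for the limits. -/

section FreePoisson

open RandomStates Real

theorem integral_sin_sq_div_add_mul_cos {A B : ℝ} (h : |B| < A) :
    ∫ θ in (0 : ℝ)..π, sin θ ^ 2 / (A + B * cos θ) = π / (A + √(A ^ 2 - B ^ 2)) := by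
  have hA : 0 < A := (abs_nonneg B).trans_lt h
  rcases eq_or_ne B 0 with rfl | hB
  · simp only [zero_mul, add_zero, intervalIntegral.integral_div, integral_sin_sq]
    simp [Real.sqrt_sq hA.le]
    field_simp
    ring
  have hD2 : 0 < A ^ 2 - B ^ 2 := by nlinarith [sq_abs B, abs_nonneg B]
  obtain ⟨D, hD, hDdef⟩ : ∃ D, 0 < D ∧ D = √(A ^ 2 - B ^ 2) := ⟨_, Real.sqrt_pos.2 hD2, rfl⟩
  have hDsq : D ^ 2 = A ^ 2 - B ^ 2 := by rw [hDdef, Real.sq_sqrt hD2.le]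
  rw [← hDdef]
  have hpos : ∀ θ, 0 < A + B * cos θ := by
    intro θ
    have : |B * cos θ| ≤ |B| := by
      rw [abs_mul]
      exact mul_le_of_le_one_right (abs_nonneg B) (abs_cos_le_one θ)
    linarith [neg_abs_le (B * cos θ)]
  -- The denominator inside the arctangent stays positive, so this primitive is smooth up to `π`,
  -- where the half-angle substitution breaks down. Only the linear term survives at the endpoints:
  -- `(A - D) π / B² = π / (A + D)`.
  have hder : ∀ θ, HasDerivAt (fun θ => ((A - D) * θ - B * sin θ +
      2 * D * arctan (B * sin θ / (A + D + B * cos θ))) / B ^ 2)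
      (sin θ ^ 2 / (A + B * cos θ)) θ := by
    intro θ
    have h1 := hpos θ
    have h2 : 0 < A + D + B * cos θ := by linarith
    have hN : HasDerivAt (fun θ => B * sin θ) (B * cos θ) θ := (hasDerivAt_sin θ).const_mul B
    have hQ : HasDerivAt (fun θ => A + D + B * cos θ) (B * -sin θ) θ :=
      ((hasDerivAt_cos θ).const_mul B).const_add _
    have hat := (hN.div hQ h2.ne').arctan
    have := ((((hasDerivAt_id θ).const_mul (A - D)).sub hN).add (hat.const_mul (2 * D))).div_const
      (B ^ 2)
    refine this.congr_deriv ?_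
    have hcs : sin θ ^ 2 = 1 - cos θ ^ 2 := by linarith [sin_sq_add_cos_sq θ]
    have hquot : 1 / (1 + (B * sin θ / (A + D + B * cos θ)) ^ 2) *
        ((B * cos θ * (A + D + B * cos θ) - B * sin θ * (B * -sin θ)) /
          (A + D + B * cos θ) ^ 2) =
        (B * cos θ + A - D) / (2 * (A + B * cos θ)) := by
      have e1 : 1 + (B * sin θ / (A + D + B * cos θ)) ^ 2 =
          2 * (A + D) * (A + B * cos θ) / (A + D + B * cos θ) ^ 2 := by
        field_simp
        linear_combination B ^ 2 * hcs + hDsq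
      rw [e1]
      have : A + D ≠ 0 := by positivity
      field_simp
      linear_combination B ^ 2 * hcs + hDsq
    simp only [mul_one]
    have hB2 : B ^ 2 ≠ 0 := pow_ne_zero 2 hB
    simp only [Pi.div_apply]
    rw [hquot, hcs]
    field_simp
    linear_combination -hDsq
  rw [intervalIntegral.integral_eq_sub_of_hasDerivAt (fun θ _ => hder θ)]
  · simp
    have : A + D ≠ 0 := by positivity
    field_simp
    linear_combination -hDsq
  · refine Continuous.intervalIntegrable ?_ _ _
    exact (continuous_sin.pow 2).div (by fun_prop) fun θ => (hpos θ).ne'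

/-- The borderline case `|B| = A` of the previous integral, needed for `c = 1`, where the support
reaches `0`. -/
theorem integral_sin_sq_div_one_add_cos :
    ∫ θ in (0 : ℝ)..π, sin θ ^ 2 / (1 + cos θ) = π := by
  have : ∫ θ in (0 : ℝ)..π, sin θ ^ 2 / (1 + cos θ) = ∫ θ in (0 : ℝ)..π, (1 - cos θ) := by
    refine intervalIntegral.integral_congr_ae ?_
    filter_upwards [Measure.ae_ne volume π] with θ hθ hmem
    rw [Set.uIoc_of_le pi_pos.le] at hmem
    have h1 : cos π < cos θ :=
      cos_lt_cos_of_nonneg_of_le_pi hmem.1.le le_rfl (lt_of_le_of_ne hmem.2 hθ)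
    rw [cos_pi] at h1
    have : 1 + cos θ ≠ 0 := by linarith
    rw [div_eq_iff this, sin_sq]
    ring
  rw [this, intervalIntegral.integral_sub (by simp) (continuous_cos.intervalIntegrable _ _)]
  simp

/-- The parametrization of the support of the free Poisson law by the upper half circle. -/
noncomputable def circleParam (c θ : ℝ) : ℝ := 1 + c + 2 * √c * cos θ

/-- The difference is `(1 + √c cos θ)²`. This yields both positivity of the parameter and
boundedness of the density, also for `c = 1`. -/
theorem mul_sin_sq_le_circleParam {c : ℝ} (hc : 0 ≤ c) (θ : ℝ) :
    c * sin θ ^ 2 ≤ circleParam c θ := by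
  have h : √c ^ 2 = c := Real.sq_sqrt hc
  have := sin_sq_add_cos_sq θ
  rw [circleParam]
  nlinarith [sq_nonneg (1 + √c * cos θ)]

theorem circleParam_nonneg {c : ℝ} (hc : 0 ≤ c) (θ : ℝ) : 0 ≤ circleParam c θ :=
  (mul_nonneg hc (sq_nonneg _)).trans (mul_sin_sq_le_circleParam hc θ)

theorem circleParam_le {c : ℝ} (hc : 0 ≤ c) (θ : ℝ) : circleParam c θ ≤ (1 + √c) ^ 2 := by
  have h : √c ^ 2 = c := Real.sq_sqrt hc
  have := mul_le_mul_of_nonneg_left (cos_le_one θ) (Real.sqrt_nonneg c)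
  rw [circleParam]
  nlinarith

theorem continuous_circleParam (c : ℝ) : Continuous (circleParam c) := by
  unfold circleParam; fun_prop

/-- The moments of a semicircle law with mean `1 + c` and variance `c`. -/
noncomputable def shiftedSemicircleMoment (c : ℝ) (k : ℕ) : ℝ :=
  2 / π * ∫ θ in (0 : ℝ)..π, sin θ ^ 2 * circleParam c θ ^ k

/-- The geometric series is summed under the integral, with terms dominated by `2⁻ᵏ`; what remains
is the integral above with `A = 1 - (1 + c) z`, `B = -2 √c z`. -/
theorem hasSum_shiftedSemicircleMoment {c : ℝ} (hc : 0 < c) {z : ℝ}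
    (hz : |z| * (1 + √c) ^ 2 ≤ 1 / 2) :
    HasSum (fun k => shiftedSemicircleMoment c k * z ^ k)
      (2 / (1 - (1 + c) * z + √((1 - (1 + c) * z) ^ 2 - 4 * c * z ^ 2))) ∧
    Summable (fun k => ‖shiftedSemicircleMoment c k * z ^ k‖) := by
  have hs : √c ^ 2 = c := Real.sq_sqrt hc.le
  have hs0 := Real.sqrt_nonneg c
  have hτ (θ : ℝ) : |circleParam c θ * z| ≤ 1 / 2 := by
    rw [abs_mul, abs_of_nonneg (circleParam_nonneg hc.le θ), mul_comm]
    exact (mul_le_mul_of_nonneg_left (circleParam_le hc.le θ) (abs_nonneg z)).trans hz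
  have hF (k : ℕ) (θ : ℝ) : ‖sin θ ^ 2 * (circleParam c θ * z) ^ k‖ ≤ (1 / 2) ^ k := by
    rw [norm_mul, norm_pow, norm_pow, Real.norm_eq_abs, Real.norm_eq_abs]
    calc |sin θ| ^ 2 * |circleParam c θ * z| ^ k ≤ 1 * (1 / 2) ^ k := by
          gcongr
          · rw [sq_abs]; exact sin_sq_le_one θ
          · exact hτ θ
      _ = _ := one_mul _
  have hterm (k : ℕ) : shiftedSemicircleMoment c k * z ^ k =
      2 / π * ∫ θ in (0 : ℝ)..π, sin θ ^ 2 * (circleParam c θ * z) ^ k := by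
    rw [shiftedSemicircleMoment, mul_assoc, ← intervalIntegral.integral_mul_const]
    simp only [mul_pow, mul_assoc]
  have hcont := continuous_circleParam c
  constructor
  · simp_rw [hterm]
    have h1 : HasSum (fun k => ∫ θ in (0 : ℝ)..π, sin θ ^ 2 * (circleParam c θ * z) ^ k)
        (∫ θ in (0 : ℝ)..π, sin θ ^ 2 / ((1 - (1 + c) * z) + (-(2 * √c * z)) * cos θ)) := by
      refine intervalIntegral.hasSum_integral_of_dominated_convergence (fun k _ => (1 / 2) ^ k) ?_ ?_ ?_ ?_ ?_
      · exact fun k => Continuous.aestronglyMeasurable (by fun_prop)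
      · exact fun k => Eventually.of_forall fun θ _ => hF k θ
      · exact Eventually.of_forall fun θ _ => summable_geometric_two
      · simp
      · refine Eventually.of_forall fun θ _ => ?_
        have h2 := (hasSum_geometric_of_abs_lt_one ((hτ θ).trans_lt (by norm_num))).mul_left
          (sin θ ^ 2)
        have e : sin θ ^ 2 / ((1 - (1 + c) * z) + (-(2 * √c * z)) * cos θ) =
            sin θ ^ 2 * (1 - circleParam c θ * z)⁻¹ := by
          simp only [circleParam, div_eq_mul_inv]
          congr 2
          ring
        rw [e]
        exact h2
    have hlt : |-(2 * √c * z)| < 1 - (1 + c) * z := by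
      have e1 : |-(2 * √c * z)| = 2 * √c * |z| := by
        rw [abs_neg, abs_mul, abs_of_nonneg (by positivity)]
      have e2 : z ≤ |z| := le_abs_self z
      have : (1 + c) * z ≤ (1 + c) * |z| := by gcongr
      rw [e1]
      nlinarith [abs_nonneg z]
    rw [integral_sin_sq_div_add_mul_cos hlt] at h1
    have : (-(2 * √c * z)) ^ 2 = 4 * c * z ^ 2 := by
      rw [neg_sq, mul_pow, mul_pow, hs]; ring
    rw [this] at h1
    have e : 2 / π * (π / (1 - (1 + c) * z + √((1 - (1 + c) * z) ^ 2 - 4 * c * z ^ 2))) =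
        2 / (1 - (1 + c) * z + √((1 - (1 + c) * z) ^ 2 - 4 * c * z ^ 2)) := by
      field_simp
    exact e ▸ h1.mul_left (2 / π)
  · refine Summable.of_nonneg_of_le (fun _ => norm_nonneg _) (fun k => ?_)
      (summable_geometric_two.mul_left 2)
    rw [hterm, norm_mul, Real.norm_of_nonneg (by positivity : (0 : ℝ) ≤ 2 / π)]
    have := intervalIntegral.norm_integral_le_of_norm_le_const (a := (0 : ℝ)) (b := π)
      (C := (1 / 2 : ℝ) ^ k) (f := fun θ => sin θ ^ 2 * (circleParam c θ * z) ^ k)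
      fun θ _ => hF k θ
    rw [sub_zero, abs_of_pos pi_pos] at this
    calc _ ≤ 2 / π * ((1 / 2) ^ k * π) := by gcongr
      _ = _ := by field_simp

/-- The power series with given coefficients converges absolutely at `z`, with a given sum. -/
def PowerSeriesSum (f : PowerSeries ℝ) (z v : ℝ) : Prop :=
  HasSum (fun k => f.coeff k * z ^ k) v ∧ Summable fun k => ‖f.coeff k * z ^ k‖

namespace PowerSeriesSum

variable {f g : PowerSeries ℝ} {z v w : ℝ}

theorem add (hf : PowerSeriesSum f z v) (hg : PowerSeriesSum g z w) :
    PowerSeriesSum (f + g) z (v + w) := by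
  have h : (fun k => (f + g).coeff k * z ^ k) =
      fun k => f.coeff k * z ^ k + g.coeff k * z ^ k := by
    ext k; rw [map_add, add_mul]
  refine ⟨h ▸ hf.1.add hg.1, ?_⟩
  simp only [map_add, add_mul]
  exact Summable.of_nonneg_of_le (fun _ => norm_nonneg _) (fun _ => norm_add_le _ _)
    (hf.2.add hg.2)

theorem mul (hf : PowerSeriesSum f z v) (hg : PowerSeriesSum g z w) :
    PowerSeriesSum (f * g) z (v * w) := by
  have h (k : ℕ) : (f * g).coeff k * z ^ k = ∑ kl ∈ Finset.HasAntidiagonal.antidiagonal k,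
      f.coeff kl.1 * z ^ kl.1 * (g.coeff kl.2 * z ^ kl.2) := by
    rw [PowerSeries.coeff_mul, Finset.sum_mul]
    refine Finset.sum_congr rfl fun kl hkl => ?_
    rw [← Finset.HasAntidiagonal.mem_antidiagonal.1 hkl, pow_add]
    ring
  have hs := summable_norm_sum_mul_antidiagonal_of_summable_norm hf.2 hg.2
  have ht := tsum_mul_tsum_eq_tsum_sum_antidiagonal_of_summable_norm hf.2 hg.2
  rw [hf.1.tsum_eq, hg.1.tsum_eq] at ht
  simp only [← h] at hs ht
  exact ⟨ht ▸ hs.of_norm.hasSum, hs⟩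

theorem C (a : ℝ) : PowerSeriesSum (PowerSeries.C a) z a := by
  have h : ∀ k, k ≠ 0 → (PowerSeries.C a).coeff k * z ^ k = 0 := fun k hk => by
    rw [PowerSeries.coeff_C, if_neg hk, zero_mul]
  refine ⟨by simpa using hasSum_single 0 h, ?_⟩
  exact summable_of_ne_finset_zero (s := {0}) fun k hk => by
    rw [h k (by simpa using hk), norm_zero]

theorem X : PowerSeriesSum PowerSeries.X z z := by
  have h : ∀ k, k ≠ 1 → (PowerSeries.X : PowerSeries ℝ).coeff k * z ^ k = 0 := fun k hk => by
    rw [PowerSeries.coeff_X, if_neg hk, zero_mul]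
  refine ⟨by simpa using hasSum_single 1 h, ?_⟩
  exact summable_of_ne_finset_zero (s := {1}) fun k hk => by
    rw [h k (by simpa using hk), norm_zero]

theorem eq_of_eventually {F : ℝ → ℝ} (hf : ∀ᶠ z in 𝓝 0, PowerSeriesSum f z (F z))
    (hg : ∀ᶠ z in 𝓝 0, PowerSeriesSum g z (F z)) : f = g := by
  have h {e : PowerSeries ℝ} (he : ∀ᶠ z in 𝓝 0, PowerSeriesSum e z (F z)) :
      HasFPowerSeriesAt F (FormalMultilinearSeries.ofScalars ℝ fun k => e.coeff k) 0 := by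
    rw [hasFPowerSeriesAt_iff]
    filter_upwards [he] with z hz
    simpa [FormalMultilinearSeries.coeff_ofScalars, mul_comm] using hz.1
  have heq := (h hf).eq_formalMultilinearSeries (h hg)
  ext k
  have := congrArg (fun p => p.coeff k) heq
  simpa [FormalMultilinearSeries.coeff_ofScalars] using this

end PowerSeriesSum

/-- The closed form of the generating function solves this quadratic equation near `0`, and power
series with equal sums near `0` coincide. -/
theorem shiftedSemicircleMoment_powerSeries {c : ℝ} (hc : 0 < c) :
    PowerSeries.mk (shiftedSemicircleMoment c) = PowerSeries.C 1 +
      PowerSeries.C (1 + c) * (PowerSeries.X * PowerSeries.mk (shiftedSemicircleMoment c)) +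
      PowerSeries.C c * (PowerSeries.X * PowerSeries.X *
        (PowerSeries.mk (shiftedSemicircleMoment c) *
          PowerSeries.mk (shiftedSemicircleMoment c))) := by
  set F : ℝ → ℝ := fun z =>
    2 / (1 - (1 + c) * z + √((1 - (1 + c) * z) ^ 2 - 4 * c * z ^ 2)) with hF
  have hM : 0 < (1 + √c) ^ 2 := by positivity
  have hz : ∀ᶠ z : ℝ in 𝓝 0, |z| * (1 + √c) ^ 2 ≤ 1 / 2 := by
    have : Tendsto (fun z : ℝ => |z| * (1 + √c) ^ 2) (𝓝 0) (𝓝 0) := by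
      have : Continuous fun z : ℝ => |z| * (1 + √c) ^ 2 := by fun_prop
      simpa using this.tendsto 0
    filter_upwards [this.eventually (gt_mem_nhds (by norm_num : (0 : ℝ) < 1 / 2))] with z hz
    exact hz.le
  have hf : ∀ z : ℝ, |z| * (1 + √c) ^ 2 ≤ 1 / 2 →
      PowerSeriesSum (PowerSeries.mk (shiftedSemicircleMoment c)) z (F z) := fun z hz => by
    simpa [PowerSeriesSum] using hasSum_shiftedSemicircleMoment hc hz
  refine PowerSeriesSum.eq_of_eventually (F := F) (hz.mono hf) ?_
  filter_upwards [hz] with z hz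
  have h := hf z hz
  have := ((PowerSeriesSum.C 1).add ((PowerSeriesSum.C (1 + c)).mul (PowerSeriesSum.X.mul h))).add
    ((PowerSeriesSum.C c).mul ((PowerSeriesSum.X.mul PowerSeriesSum.X).mul (h.mul h)))
  convert this using 1
  have hs : √c ^ 2 = c := Real.sq_sqrt hc.le
  have hs0 := Real.sqrt_nonneg c
  have hcz : 2 * √c * |z| < 1 - (1 + c) * z := by
    have e2 : z ≤ |z| := le_abs_self z
    have : (1 + c) * z ≤ (1 + c) * |z| := by gcongr
    nlinarith [abs_nonneg z]
  have hdisc : 0 ≤ (1 - (1 + c) * z) ^ 2 - 4 * c * z ^ 2 := by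
    have h1 : (2 * √c * |z|) ^ 2 = 4 * c * z ^ 2 := by rw [mul_pow, mul_pow, hs, sq_abs]; ring
    rw [← h1]
    have : 0 ≤ 2 * √c * |z| := by positivity
    nlinarith
  have hA : 0 < 1 - (1 + c) * z := lt_of_le_of_lt (by positivity) hcz
  simp only [hF]
  have hD := Real.sq_sqrt hdisc
  have hD0 := Real.sqrt_nonneg ((1 - (1 + c) * z) ^ 2 - 4 * c * z ^ 2)
  generalize √((1 - (1 + c) * z) ^ 2 - 4 * c * z ^ 2) = D at *
  have : 1 - (1 + c) * z + D ≠ 0 := by positivity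
  field_simp
  linear_combination -hD

theorem shiftedSemicircleMoment_zero {c : ℝ} (hc : 0 < c) : shiftedSemicircleMoment c 0 = 1 := by
  have := congrArg (PowerSeries.coeff 0) (shiftedSemicircleMoment_powerSeries hc)
  simpa using this

theorem shiftedSemicircleMoment_succ {c : ℝ} (hc : 0 < c) (k : ℕ) :
    shiftedSemicircleMoment c (k + 1) = (1 + c) * shiftedSemicircleMoment c k +
      c * ∑ a ∈ Finset.range k, shiftedSemicircleMoment c a *
        shiftedSemicircleMoment c (k - 1 - a) := by
  have := congrArg (PowerSeries.coeff (k + 1)) (shiftedSemicircleMoment_powerSeries hc)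
  rw [map_add, map_add, PowerSeries.coeff_C_mul, PowerSeries.coeff_C_mul,
    PowerSeries.coeff_succ_X_mul, mul_assoc PowerSeries.X, PowerSeries.coeff_succ_X_mul,
    PowerSeries.coeff_C, if_neg (Nat.succ_ne_zero k), zero_add] at this
  simp only [PowerSeries.coeff_mk] at this
  rw [this]
  cases k with
  | zero => simp
  | succ k =>
    rw [PowerSeries.coeff_succ_X_mul, PowerSeries.coeff_mul,
      Finset.Nat.sum_antidiagonal_eq_sum_range_succ_mk]
    simp

/-- The last term of the loop recursion is the only one containing `loopMoment c 0 = c`; split off,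
it turns the coefficient `1` into the `1 + c` of the semicircle recursion. -/
theorem loopMoment_succ_eq {c : ℝ} (hc : 0 < c) (k : ℕ) :
    loopMoment c (k + 1) = c * shiftedSemicircleMoment c k := by
  induction k using Nat.strong_induction_on with
  | _ k ih =>
    cases k with
    | zero =>
      rw [loopMoment_succ]
      simp [loopMoment_zero, shiftedSemicircleMoment_zero hc]
    | succ k =>
      rw [loopMoment_succ, Finset.sum_range_succ, ih k (by omega), shiftedSemicircleMoment_succ hc]
      have h : ∀ a ∈ Finset.range k, loopMoment c (a + 1) * loopMoment c (k + 1 - 1 - a) =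
          c * c * (shiftedSemicircleMoment c a * shiftedSemicircleMoment c (k - 1 - a)) := by
        intro a ha
        have := Finset.mem_range.1 ha
        rw [ih a (by omega), show k + 1 - 1 - a = (k - 1 - a) + 1 by omega, ih _ (by omega)]
        ring
      rw [Finset.sum_congr rfl h, ← Finset.mul_sum, Nat.add_sub_cancel, Nat.sub_self,
        loopMoment_zero]
      ring

end FreePoisson

/-! ### Mass, support and moments of the free Poisson law. -/

section FreePoissonMoments

open RandomStates Real

theorem circleParam_image_Icc {c : ℝ} (hc : 0 < c) :
    circleParam c '' Set.Icc 0 π = Set.uIcc (1 * (1 - √c) ^ 2) (1 * (1 + √c) ^ 2) := by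
  have hs : √c ^ 2 = c := Real.sq_sqrt hc.le
  have hs0 : 0 < √c := Real.sqrt_pos.2 hc
  rw [Set.uIcc_of_le (by nlinarith)]
  ext t
  simp only [Set.mem_image, Set.mem_Icc, circleParam]
  constructor
  · rintro ⟨θ, -, rfl⟩
    constructor <;> nlinarith [cos_le_one θ, neg_one_le_cos θ]
  · rintro ⟨h1, h2⟩
    refine ⟨arccos ((t - (1 + c)) / (2 * √c)), ⟨arccos_nonneg _, arccos_le_pi _⟩, ?_⟩
    rw [cos_arccos]
    · field_simp; ring
    · rw [le_div_iff₀ (by positivity)]; nlinarith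
    · rw [div_le_iff₀ (by positivity)]; nlinarith

/-- The density of the absolutely continuous part of the free Poisson law in the parameter of
`circleParam`. -/
noncomputable def circleDensity (c θ : ℝ) : ℝ := 2 * c / π * (sin θ ^ 2 / circleParam c θ)

theorem circleDensity_nonneg {c : ℝ} (hc : 0 < c) (θ : ℝ) : 0 ≤ circleDensity c θ :=
  mul_nonneg (by positivity) (div_nonneg (sq_nonneg _) (circleParam_nonneg hc.le θ))

theorem circleDensity_le {c : ℝ} (hc : 0 < c) (θ : ℝ) : circleDensity c θ ≤ 2 / π := by
  have h : c * (sin θ ^ 2 / circleParam c θ) ≤ 1 := by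
    rw [← mul_div_assoc]
    exact div_le_one_of_le₀ (mul_sin_sq_le_circleParam hc.le θ) (circleParam_nonneg hc.le θ)
  calc circleDensity c θ = 2 / π * (c * (sin θ ^ 2 / circleParam c θ)) := by
        rw [circleDensity]; ring
    _ ≤ 2 / π * 1 := by gcongr
    _ = _ := mul_one _

theorem measurable_circleDensity (c : ℝ) : Measurable (circleDensity c) := by
  have := (continuous_circleParam c).measurable
  unfold circleDensity
  fun_prop

/-- The measure on the parameter interval whose image is the absolutely continuous part of the free
Poisson law. -/
noncomputable def circleMeasure (c : ℝ) : Measure ℝ :=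
  (volume.restrict (Set.Icc 0 π)).withDensity fun θ => ENNReal.ofReal (circleDensity c θ)

/-- Substitution `t = circleParam c θ`: the square root in the density and the Jacobian both equal
`2 √c sin θ`. -/
theorem freePoisson_eq_map {c : ℝ} (hc : 0 < c) :
    freePoisson c 1 = ENNReal.ofReal (1 - c) • Measure.dirac 0 +
      (circleMeasure c).map (circleParam c) := by
  have hs : √c ^ 2 = c := Real.sq_sqrt hc.le
  have hs0 : 0 < √c := Real.sqrt_pos.2 hc
  have hτ := (continuous_circleParam c).measurable
  have hder : ∀ θ ∈ Set.Icc 0 π,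
      HasDerivWithinAt (circleParam c) (2 * √c * -sin θ) (Set.Icc 0 π) θ := fun θ _ =>
    (((hasDerivAt_cos θ).const_mul _).const_add _).hasDerivWithinAt
  have hinj : Set.InjOn (circleParam c) (Set.Icc 0 π) := by
    intro x hx y hy hxy
    refine injOn_cos hx hy ?_
    simp only [circleParam] at hxy
    have : 2 * √c * cos x = 2 * √c * cos y := by linarith
    exact mul_left_cancel₀ (by positivity) this
  rw [freePoisson]
  congr 1
  ext s hms
  rw [Measure.map_apply hτ hms, circleMeasure, withDensity_apply _ hms,
    withDensity_apply _ (hτ hms), ← lintegral_indicator hms, ← lintegral_indicator (hτ hms),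
    ← circleParam_image_Icc hc,
    lintegral_image_eq_lintegral_abs_deriv_mul measurableSet_Icc hder hinj]
  · refine setLIntegral_congr_fun measurableSet_Icc fun θ hθ => ?_
    have hsin : 0 ≤ sin θ := sin_nonneg_of_nonneg_of_le_pi hθ.1 hθ.2
    by_cases h : circleParam c θ ∈ s
    · rw [Set.indicator_of_mem h, Set.indicator_of_mem (show θ ∈ circleParam c ⁻¹' s from h),
        ← ENNReal.ofReal_mul (abs_nonneg _)]
      congr 1
      have h1 : |2 * √c * -sin θ| = 2 * √c * sin θ := by
        rw [mul_neg, abs_neg, abs_of_nonneg (by positivity)]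
      have h2 : √(4 * c * 1 ^ 2 - (circleParam c θ - 1 * (1 + c)) ^ 2) = 2 * √c * sin θ := by
        rw [show 4 * c * 1 ^ 2 - (circleParam c θ - 1 * (1 + c)) ^ 2 = (2 * √c * sin θ) ^ 2 by
          rw [circleParam, mul_pow _ (sin θ), sin_sq]
          linear_combination (-4 : ℝ) * hs]
        exact Real.sqrt_sq (by positivity)
      rw [h1, h2, circleDensity, ← mul_div_assoc,
        show 2 * √c * sin θ * (2 * √c * sin θ) = 4 * c * sin θ ^ 2 by
          linear_combination 4 * sin θ ^ 2 * hs]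
      -- If the parameter vanishes, division by zero makes both sides `0`.
      rcases eq_or_ne (circleParam c θ) 0 with h0 | h0
      · simp [h0]
      · field_simp; ring
    · rw [Set.indicator_of_notMem h, Set.indicator_of_notMem
        (show θ ∉ circleParam c ⁻¹' s from h), mul_zero]

theorem integral_circleMeasure {c : ℝ} (hc : 0 < c) (g : ℝ → ℝ) :
    ∫ θ, g θ ∂circleMeasure c = ∫ θ in (0 : ℝ)..π, circleDensity c θ * g θ := by
  rw [circleMeasure, integral_withDensity_eq_integral_toReal_smul
    (measurable_circleDensity c).ennreal_ofReal (Eventually.of_forall fun _ => ENNReal.ofReal_lt_top),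
    intervalIntegral.integral_of_le pi_pos.le, ← integral_Icc_eq_integral_Ioc]
  simp only [ENNReal.toReal_ofReal (circleDensity_nonneg hc _), smul_eq_mul]

/-- Here `√(A² - B²) = |1 - c|`, so the denominator `A + |1 - c|` is `2 max 1 c`. The atom supplies
the missing mass when `c < 1`. -/
theorem integral_circleDensity {c : ℝ} (hc : 0 < c) :
    ∫ θ in (0 : ℝ)..π, circleDensity c θ = min c 1 := by
  have hs : √c ^ 2 = c := Real.sq_sqrt hc.le
  simp only [circleDensity, intervalIntegral.integral_const_mul]
  rcases eq_or_ne c 1 with rfl | h1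
  · have : ∫ θ in (0 : ℝ)..π, sin θ ^ 2 / circleParam 1 θ =
        ∫ θ in (0 : ℝ)..π, (1 / 2) * (sin θ ^ 2 / (1 + cos θ)) := by
      congr 1
      ext θ
      rw [circleParam, Real.sqrt_one, show 1 + 1 + 2 * 1 * cos θ = 2 * (1 + cos θ) by ring,
        div_mul_eq_div_div_swap]
      ring
    rw [this, intervalIntegral.integral_const_mul, integral_sin_sq_div_one_add_cos]
    simp
    field_simp
  · have hsq : (2 * √c) ^ 2 = 4 * c := by rw [mul_pow, hs]; ring
    have hdisc : (1 + c) ^ 2 - (2 * √c) ^ 2 = (1 - c) ^ 2 := by rw [hsq]; ring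
    have hlt : |2 * √c| < 1 + c := by
      rw [abs_of_nonneg (by positivity)]
      refine lt_of_pow_lt_pow_left₀ 2 (by positivity) ?_
      have : 0 < (1 - c) ^ 2 := by
        have : 1 - c ≠ 0 := sub_ne_zero.2 h1.symm
        positivity
      linarith
    have := integral_sin_sq_div_add_mul_cos hlt
    rw [hdisc, Real.sqrt_sq_eq_abs] at this
    simp only [circleParam]
    rw [this]
    rcases le_total c 1 with h | h
    · rw [min_eq_left h, abs_of_nonneg (by linarith)]
      field_simp
      ring
    · rw [min_eq_right h, abs_of_nonpos (by linarith), show 1 + c + -(1 - c) = 2 * c by ring]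
      field_simp

theorem circleMeasure_univ {c : ℝ} (hc : 0 < c) :
    circleMeasure c Set.univ = ENNReal.ofReal (min c 1) := by
  rw [circleMeasure, withDensity_apply _ .univ, Measure.restrict_univ,
    ← integral_circleDensity hc, intervalIntegral.integral_of_le pi_pos.le,
    ← integral_Icc_eq_integral_Ioc, ofReal_integral_eq_lintegral_ofReal]
  · refine Integrable.of_bound (measurable_circleDensity c).aestronglyMeasurable (2 / π)
      (Eventually.of_forall fun θ => ?_)
    rw [Real.norm_of_nonneg (circleDensity_nonneg hc θ)]
    exact circleDensity_le hc θ
  · exact Eventually.of_forall fun θ => circleDensity_nonneg hc θ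

theorem isProbabilityMeasure_freePoisson {c : ℝ} (hc : 0 < c) :
    IsProbabilityMeasure (freePoisson c 1) := by
  refine ⟨?_⟩
  rw [freePoisson_eq_map hc, Measure.add_apply, Measure.smul_apply,
    Measure.map_apply (continuous_circleParam c).measurable .univ, Set.preimage_univ,
    circleMeasure_univ hc, measure_univ, smul_eq_mul, mul_one]
  rcases le_total c 1 with h | h
  · rw [min_eq_left h, ← ENNReal.ofReal_add (by linarith) hc.le]
    simp
  · rw [min_eq_right h, ENNReal.ofReal_of_nonpos (by linarith)]
    simp

theorem ae_mem_Icc_freePoisson {c : ℝ} (hc : 0 < c) :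
    ∀ᵐ x ∂freePoisson c 1, x ∈ Set.Icc 0 ((1 + √c) ^ 2) := by
  rw [freePoisson_eq_map hc, ae_add_measure_iff]
  constructor
  · refine Measure.ae_smul_measure ?_ _
    exact (ae_dirac_iff (p := (· ∈ Set.Icc 0 ((1 + √c) ^ 2))) measurableSet_Icc).2
      ⟨le_rfl, by positivity⟩
  · exact (ae_map_iff (p := (· ∈ Set.Icc 0 ((1 + √c) ^ 2)))
      (continuous_circleParam c).measurable.aemeasurable measurableSet_Icc).2
      (Eventually.of_forall fun θ => ⟨circleParam_nonneg hc.le θ, circleParam_le hc.le θ⟩)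

/-- For `k ≥ 1` the atom at `0` contributes nothing and one factor `t` cancels the `1 / t` of the
density. Order `0` is excluded, as `loopMoment c 0` is `c`, not the total mass. -/
theorem integral_pow_freePoisson {c : ℝ} (hc : 0 < c) {k : ℕ} (hk : k ≠ 0) :
    ∫ x, x ^ k ∂freePoisson c 1 = loopMoment c k := by
  have := isProbabilityMeasure_freePoisson hc
  have hint : Integrable (fun x : ℝ => x ^ k) (freePoisson c 1) := by
    refine Integrable.of_bound (by fun_prop) (((1 + √c) ^ 2) ^ k) ?_
    filter_upwards [ae_mem_Icc_freePoisson hc] with x hx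
    rw [norm_pow, Real.norm_of_nonneg hx.1]
    exact pow_le_pow_left₀ hx.1 hx.2 k
  rw [freePoisson_eq_map hc] at hint ⊢
  obtain ⟨k, rfl⟩ := Nat.exists_eq_succ_of_ne_zero hk
  rw [integral_add_measure hint.left_of_add_measure hint.right_of_add_measure,
    integral_smul_measure, integral_dirac,
    integral_map (continuous_circleParam c).measurable.aemeasurable (by fun_prop),
    integral_circleMeasure hc, loopMoment_succ_eq hc, shiftedSemicircleMoment]
  rw [zero_pow hk, smul_zero, zero_add, ← mul_assoc, ← intervalIntegral.integral_const_mul]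
  congr 1
  ext θ
  rw [circleDensity, Nat.succ_eq_add_one, pow_succ (circleParam c θ)]
  rcases eq_or_ne (circleParam c θ) 0 with h0 | h0
  · have h1 := mul_sin_sq_le_circleParam hc.le θ
    rw [h0] at h1
    have h2 : sin θ ^ 2 = 0 := by
      have := sq_nonneg (sin θ)
      nlinarith
    simp [h2]
  · field_simp

theorem ofReal_one_sub_le_freePoisson_singleton {c : ℝ} (hc : 0 < c) :
    ENNReal.ofReal (1 - c) ≤ freePoisson c 1 {0} := by
  rw [freePoisson_eq_map hc, Measure.add_apply, Measure.smul_apply,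
    Measure.dirac_apply' _ (measurableSet_singleton 0)]
  simp

end FreePoissonMoments

/-! ### The law of `B √(X₁ X₂)`. -/

section SignedSqrtProduct

open RandomStates

instance isProbabilityMeasure_uniformSign : IsProbabilityMeasure uniformSign := by
  refine ⟨?_⟩
  simp [uniformSign, ENNReal.inv_two_add_inv_two]

theorem integral_pow_uniformSign (p : ℕ) :
    ∫ x, x ^ p ∂uniformSign = (1 + (-1) ^ p) / 2 := by
  have h (a : ℝ) : Integrable (fun x : ℝ => x ^ p) ((2 : ENNReal)⁻¹ • Measure.dirac a) :=
    Integrable.smul_measure (integrable_dirac (by simp)) (by simp)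
  rw [uniformSign, integral_add_measure (h 1) (h (-1)), integral_smul_measure,
    integral_smul_measure, integral_dirac, integral_dirac]
  simp
  ring

theorem measurable_signedSqrtProduct :
    Measurable fun p : ℝ × ℝ × ℝ => p.1 * √(p.2.1 * p.2.2) := by
  fun_prop

instance isProbabilityMeasure_signedSqrtProductLaw (ν : Measure ℝ) [IsProbabilityMeasure ν] :
    IsProbabilityMeasure (signedSqrtProductLaw ν) :=
  Measure.isProbabilityMeasure_map measurable_signedSqrtProduct.aemeasurable

theorem integral_pow_signedSqrtProductLaw (ν : Measure ℝ) [IsProbabilityMeasure ν] (p : ℕ) :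
    ∫ x, x ^ p ∂signedSqrtProductLaw ν =
      (1 + (-1) ^ p) / 2 * ∫ q : ℝ × ℝ, √(q.1 * q.2) ^ p ∂(ν.prod ν) := by
  rw [signedSqrtProductLaw, integral_map measurable_signedSqrtProduct.aemeasurable (by fun_prop)]
  simp only [mul_pow]
  rw [integral_prod_mul (fun b : ℝ => b ^ p) (fun q : ℝ × ℝ => √(q.1 * q.2) ^ p),
    integral_pow_uniformSign]

/-- An even power removes both sign and square root, and independence factors the mean. -/
theorem integral_pow_even_signedSqrtProductLaw {ν : Measure ℝ} [IsProbabilityMeasure ν]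
    (h : ∀ᵐ x ∂ν, 0 ≤ x) (k : ℕ) :
    ∫ x, x ^ (2 * k) ∂signedSqrtProductLaw ν = (∫ x, x ^ k ∂ν) ^ 2 := by
  have h1 : ∫ q : ℝ × ℝ, √(q.1 * q.2) ^ (2 * k) ∂(ν.prod ν) =
      ∫ q : ℝ × ℝ, q.1 ^ k * q.2 ^ k ∂(ν.prod ν) := by
    refine integral_congr_ae ?_
    filter_upwards [Measure.quasiMeasurePreserving_fst.ae h,
      Measure.quasiMeasurePreserving_snd.ae h] with q hq1 hq2
    rw [pow_mul, Real.sq_sqrt (mul_nonneg hq1 hq2), mul_pow]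
  rw [integral_pow_signedSqrtProductLaw, h1, integral_prod_mul (fun x : ℝ => x ^ k)
    (fun x : ℝ => x ^ k), pow_mul]
  norm_num
  ring

theorem integral_pow_odd_signedSqrtProductLaw (ν : Measure ℝ) [IsProbabilityMeasure ν] (k : ℕ) :
    ∫ x, x ^ (2 * k + 1) ∂signedSqrtProductLaw ν = 0 := by
  rw [integral_pow_signedSqrtProductLaw, pow_succ, pow_mul]
  norm_num

theorem ae_abs_le_signedSqrtProductLaw {ν : Measure ℝ} [IsProbabilityMeasure ν] {R : ℝ}
    (hR : 0 ≤ R) (h : ∀ᵐ x ∂ν, x ∈ Set.Icc 0 R) :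
    ∀ᵐ x ∂signedSqrtProductLaw ν, |x| ≤ R := by
  rw [signedSqrtProductLaw, ae_map_iff measurable_signedSqrtProduct.aemeasurable
    (measurableSet_le measurable_abs measurable_const)]
  have hb : ∀ᵐ b ∂uniformSign, |b| ≤ 1 := by
    rw [uniformSign, ae_add_measure_iff]
    constructor <;>
    · refine Measure.ae_smul_measure ?_ _
      rw [ae_dirac_iff (measurableSet_le measurable_abs measurable_const)]
      simp
  have hq : ∀ᵐ q ∂(ν.prod ν), √(q.1 * q.2) ≤ R := by
    filter_upwards [Measure.quasiMeasurePreserving_fst.ae h,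
      Measure.quasiMeasurePreserving_snd.ae h] with q hq1 hq2
    refine Real.sqrt_le_iff.2 ⟨hR, ?_⟩
    rw [sq]
    exact mul_le_mul hq1.2 hq2.2 hq2.1 hR
  filter_upwards [Measure.quasiMeasurePreserving_fst.ae hb,
      Measure.quasiMeasurePreserving_snd.ae hq] with p h1 h2
  rw [abs_mul, abs_of_nonneg (Real.sqrt_nonneg _)]
  calc _ ≤ 1 * R := mul_le_mul h1 h2 (Real.sqrt_nonneg _) zero_le_one
    _ = R := one_mul R

theorem le_signedSqrtProductLaw_singleton (ν : Measure ℝ) [IsProbabilityMeasure ν] :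
    ν {0} ≤ signedSqrtProductLaw ν {0} := by
  rw [signedSqrtProductLaw, Measure.map_apply measurable_signedSqrtProduct
    (measurableSet_singleton 0)]
  calc ν {0} = (uniformSign.prod (ν.prod ν)) (Set.univ ×ˢ ({0} ×ˢ Set.univ)) := by
        rw [Measure.prod_prod, Measure.prod_prod]; simp
    _ ≤ _ := measure_mono fun p hp => by
        have : p.2.1 = 0 := hp.2.1
        simp [this]

end SignedSqrtProduct

/-! ### Weak convergence from convergence of moments. -/

section MethodOfMoments

/-- The method of moments, for a limit law with bounded support. -/
theorem tendsto_of_tendsto_moments {ι : Type*} {F : Filter ι} {μs : ι → ProbabilityMeasure ℝ}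
    {μ : ProbabilityMeasure ℝ} {R : ℝ} (hR : 0 ≤ R) (hμ : ∀ᵐ x ∂(μ : Measure ℝ), |x| ≤ R)
    (hint : ∀ i (p : ℕ), Integrable (fun x : ℝ => x ^ p) (μs i : Measure ℝ))
    (h : ∀ p : ℕ, Tendsto (fun i => ∫ x, x ^ p ∂(μs i : Measure ℝ)) F
      (𝓝 (∫ x, x ^ p ∂(μ : Measure ℝ)))) : Tendsto μs F (𝓝 μ) := by
  rw [ProbabilityMeasure.tendsto_iff_forall_integral_tendsto]
  intro f
  have hintμ (p : ℕ) : Integrable (fun x : ℝ => x ^ p) (μ : Measure ℝ) := by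
    refine Integrable.of_bound (by fun_prop) (R ^ p) ?_
    filter_upwards [hμ] with x hx
    rw [norm_pow]
    exact pow_le_pow_left₀ (norm_nonneg _) hx p
  have hfint (ν : ProbabilityMeasure ℝ) : Integrable f (ν : Measure ℝ) := f.integrable _
  rw [Metric.tendsto_nhds]
  intro ε' hε'
  -- Five errors: polynomial approximation and tail for each of the two measures, and the difference
  -- of the polynomial integrals.
  obtain ⟨ε, hε, hεε⟩ : ∃ ε, 0 < ε ∧ 5 * ε ≤ ε' := ⟨ε' / 5, by positivity, by linarith⟩
  set K := R + 1 with hK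
  have hK1 : 1 ≤ K := by linarith
  obtain ⟨q, hq⟩ := exists_polynomial_near_of_continuousOn (-K) K f f.continuous.continuousOn ε hε
  have hqint {ν : ProbabilityMeasure ℝ} (hν : ∀ p : ℕ, Integrable (fun x : ℝ => x ^ p)
      (ν : Measure ℝ)) : Integrable (fun x => q.eval x) (ν : Measure ℝ) := by
    simp only [Polynomial.eval_eq_sum_range]
    exact integrable_finsetSum _ fun p _ => (hν p).const_mul _
  have hqval {ν : ProbabilityMeasure ℝ} (hν : ∀ p : ℕ, Integrable (fun x : ℝ => x ^ p)
      (ν : Measure ℝ)) : ∫ x, q.eval x ∂(ν : Measure ℝ) =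
        ∑ p ∈ Finset.range (q.natDegree + 1), q.coeff p * ∫ x, x ^ p ∂(ν : Measure ℝ) := by
    simp only [Polynomial.eval_eq_sum_range]
    rw [integral_finsetSum _ fun p _ => (hν p).const_mul _]
    simp only [integral_const_mul]
  have hqlim : Tendsto (fun i => ∫ x, q.eval x ∂(μs i : Measure ℝ)) F
      (𝓝 (∫ x, q.eval x ∂(μ : Measure ℝ))) := by
    simp_rw [hqval (hint _), hqval hintμ]
    exact tendsto_finsetSum _ fun p _ => (h p).const_mul _
  set d := q.natDegree with hd
  set A := ∑ p ∈ Finset.range (d + 1), |q.coeff p| with hA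
  set C := (‖f‖ + A) * K ^ d with hC
  have hA0 : 0 ≤ A := Finset.sum_nonneg fun _ _ => abs_nonneg _
  have hC0 : 0 ≤ C := by positivity
  -- Outside `[-K, K]` both `f` and `q` are at most a constant times `|x| ^ d`, which `K ^ d (x / K)
  -- ^ (2j)` dominates. Thus one even moment controls the tail, with no uniform bound on the
  -- supports.
  have hbound (j : ℕ) (hj : d ≤ 2 * j) (x : ℝ) :
      |q.eval x - f x| ≤ ε + C * (K⁻¹ ^ (2 * j) * x ^ (2 * j)) := by
    have hnn : 0 ≤ K⁻¹ ^ (2 * j) * x ^ (2 * j) := by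
      rw [pow_mul x]; positivity
    by_cases hx : x ∈ Set.Icc (-K) K
    · have := mul_nonneg hC0 hnn
      linarith [(hq x hx).le]
    · have hxK : K < |x| := by
        rw [Set.mem_Icc, ← abs_le, not_le] at hx
        exact hx
      have hx1 : 1 ≤ |x| := hK1.trans hxK.le
      have h1 : |q.eval x| ≤ A * |x| ^ d := by
        rw [Polynomial.eval_eq_sum_range, hA, Finset.sum_mul]
        refine (Finset.abs_sum_le_sum_abs _ _).trans (Finset.sum_le_sum fun p hp => ?_)
        rw [abs_mul, abs_pow]
        have : p ≤ d := Nat.lt_succ_iff.1 (Finset.mem_range.1 hp)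
        gcongr
      have h2 : |f x| ≤ ‖f‖ * |x| ^ d :=
        (f.norm_coe_le_norm x).trans (le_mul_of_one_le_right (norm_nonneg _) (one_le_pow₀ hx1))
      have h3 : |x| ^ d ≤ K ^ d * (K⁻¹ ^ (2 * j) * x ^ (2 * j)) := by
        have e1 : x ^ (2 * j) = |x| ^ (2 * j) := by rw [pow_mul, pow_mul, sq_abs]
        have e2 : 1 ≤ K⁻¹ * |x| := by
          rw [← div_eq_inv_mul, one_le_div (by linarith)]; exact hxK.le
        have e3 := pow_le_pow_right₀ e2 hj
        rw [e1, ← mul_pow]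
        calc |x| ^ d = K ^ d * (K⁻¹ * |x|) ^ d := by
              rw [← mul_pow, ← mul_assoc, mul_inv_cancel₀ (by linarith), one_mul]
          _ ≤ _ := by gcongr
      calc |q.eval x - f x| ≤ |q.eval x| + |f x| := abs_sub _ _
        _ ≤ (‖f‖ + A) * |x| ^ d := by linarith
        _ ≤ (‖f‖ + A) * (K ^ d * (K⁻¹ ^ (2 * j) * x ^ (2 * j))) := by gcongr
        _ ≤ _ := by rw [hC, mul_assoc]; linarith
  -- Since `K > R`, the tail bound for the limit law decays like `(R / K) ^ (2j)`.
  obtain ⟨j, hj, hjε⟩ : ∃ j : ℕ, d ≤ 2 * j ∧ C * (K⁻¹ ^ (2 * j) * R ^ (2 * j)) < ε := by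
    have hlt : K⁻¹ * R < 1 := by
      rw [← div_eq_inv_mul, div_lt_one (by linarith)]; linarith
    have ht : Tendsto (fun j : ℕ => C * (K⁻¹ * R) ^ j) atTop (𝓝 (C * 0)) :=
      (tendsto_pow_atTop_nhds_zero_of_lt_one (by positivity) hlt).const_mul C
    rw [mul_zero] at ht
    have ht2 : Tendsto (fun j : ℕ => 2 * j) atTop atTop :=
      tendsto_id.const_mul_atTop' (by norm_num)
    obtain ⟨j, h1, h2⟩ := (((ht.comp ht2).eventually (gt_mem_nhds hε)).and
      (eventually_ge_atTop d)).exists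
    exact ⟨j, by omega, by simpa [mul_pow] using h1⟩
  have hdiff {ν : ProbabilityMeasure ℝ} (hν : ∀ p : ℕ, Integrable (fun x : ℝ => x ^ p)
      (ν : Measure ℝ)) : |∫ x, q.eval x ∂(ν : Measure ℝ) - ∫ x, f x ∂(ν : Measure ℝ)| ≤
        ε + C * (K⁻¹ ^ (2 * j) * ∫ x, x ^ (2 * j) ∂(ν : Measure ℝ)) := by
    rw [← integral_sub (hqint hν) (hfint ν)]
    have hi : Integrable (fun x : ℝ => C * (K⁻¹ ^ (2 * j) * x ^ (2 * j))) (ν : Measure ℝ) :=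
      ((hν _).const_mul _).const_mul _
    calc _ ≤ ∫ x, |q.eval x - f x| ∂(ν : Measure ℝ) := abs_integral_le_integral_abs
      _ ≤ ∫ x, (ε + C * (K⁻¹ ^ (2 * j) * x ^ (2 * j))) ∂(ν : Measure ℝ) :=
          integral_mono ((hqint hν).sub (hfint ν)).abs ((integrable_const _).add hi)
            (hbound j hj)
      _ = _ := by
          rw [integral_add (integrable_const _) hi, integral_const_mul, integral_const_mul]
          simp
  have hmom : ∫ x, x ^ (2 * j) ∂(μ : Measure ℝ) ≤ R ^ (2 * j) := by
    calc _ ≤ ∫ _, R ^ (2 * j) ∂(μ : Measure ℝ) := by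
          refine integral_mono_ae (hintμ _) (integrable_const _) ?_
          filter_upwards [hμ] with x hx
          rw [pow_mul, pow_mul, ← sq_abs]
          gcongr
      _ = _ := by simp
  have hμj : C * (K⁻¹ ^ (2 * j) * ∫ x, x ^ (2 * j) ∂(μ : Measure ℝ)) < ε := by
    refine lt_of_le_of_lt ?_ hjε
    gcongr
  have hlim := ((h (2 * j)).const_mul (K⁻¹ ^ (2 * j))).const_mul C
  filter_upwards [hlim.eventually (gt_mem_nhds hμj), Metric.tendsto_nhds.1 hqlim ε hε] with i h1 h2
  have h3 := hdiff (hint i)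
  have h4 := hdiff hintμ
  rw [Real.dist_eq] at h2 ⊢
  rw [abs_lt] at h2 ⊢
  rw [abs_le] at h3 h4
  constructor <;> linarith

end MethodOfMoments

/-! ### Positivity of the signed combination. -/

section LimitLaw

/-- The measure `a δ₀ + b ν`, where the mass of `ν` at `0` is merged into the coefficient of `δ₀`, so
that `a` may be negative. -/
noncomputable def diracCombination (a b : ℝ) (ν : Measure ℝ) : Measure ℝ :=
  ENNReal.ofReal (a + b * ν.real {0}) • Measure.dirac 0 + ENNReal.ofReal b • ν.restrict {0}ᶜ

variable {a b : ℝ} {ν : Measure ℝ}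

theorem diracCombination_real [IsProbabilityMeasure ν] (hb : 0 ≤ b) (h0 : 0 ≤ a + b * ν.real {0}) {s : Set ℝ}
    (hs : MeasurableSet s) : (diracCombination a b ν).real s =
      a * (Measure.dirac (0 : ℝ)).real s + b * ν.real s := by
  have h1 : ν.real s = ν.real (s ∩ {0}) + ν.real (s ∩ {0}ᶜ) :=
    (measureReal_inter_add_sdiff (μ := ν) (measurableSet_singleton (0 : ℝ))).symm
  have h2 : ν.real (s ∩ {0}) = ν.real {0} * (Measure.dirac (0 : ℝ)).real s := by
    by_cases h : (0 : ℝ) ∈ s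
    · rw [Set.inter_eq_right.2 (Set.singleton_subset_iff.2 h)]
      simp [h, measureReal_def]
    · simp [h, hs, measureReal_def]
  have hfin (r : ℝ) (κ : Measure ℝ) [IsFiniteMeasure κ] : (ENNReal.ofReal r • κ) s ≠ ⊤ := by
    rw [Measure.smul_apply, smul_eq_mul]
    exact ENNReal.mul_ne_top ENNReal.ofReal_ne_top (measure_ne_top _ _)
  rw [diracCombination, measureReal_add_apply (hfin _ _) (hfin _ _), measureReal_ennreal_smul_apply,
    measureReal_ennreal_smul_apply, ENNReal.toReal_ofReal h0, ENNReal.toReal_ofReal hb,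
    measureReal_restrict_apply hs, h1, h2]
  ring

theorem isProbabilityMeasure_diracCombination [IsProbabilityMeasure ν] (hb : 0 ≤ b) (h0 : 0 ≤ a + b * ν.real {0})
    (hab : a + b = 1) : IsProbabilityMeasure (diracCombination a b ν) := by
  have h := diracCombination_real hb h0 MeasurableSet.univ
  rw [probReal_univ (μ := Measure.dirac (0 : ℝ)), probReal_univ (μ := ν), mul_one, mul_one, hab] at h
  refine ⟨?_⟩
  rw [measureReal_def] at h
  rwa [← ENNReal.toReal_eq_one_iff]

theorem ae_diracCombination {p : ℝ → Prop} (hp : MeasurableSet {x | p x}) (h0 : p 0)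
    (h : ∀ᵐ x ∂ν, p x) : ∀ᵐ x ∂diracCombination a b ν, p x := by
  rw [diracCombination, ae_add_measure_iff]
  exact ⟨Measure.ae_smul_measure ((ae_dirac_iff hp).2 h0) _,
    Measure.ae_smul_measure (ae_restrict_of_ae h) _⟩

/-- As `f` vanishes at `0`, the atom does not matter, and no sign condition on its coefficient is
needed. -/
theorem integral_diracCombination (hb : 0 ≤ b) {f : ℝ → ℝ} (hf : Integrable f ν) (h0 : f 0 = 0) :
    ∫ x, f x ∂diracCombination a b ν = b * ∫ x, f x ∂ν := by
  rw [diracCombination, integral_add_measure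
    (Integrable.smul_measure (integrable_dirac (by simp)) (by simp))
    (Integrable.smul_measure hf.restrict (by simp)), integral_smul_measure, integral_smul_measure,
    integral_dirac, h0, smul_zero, zero_add, ENNReal.toReal_ofReal hb, smul_eq_mul,
    setIntegral_eq_integral_of_forall_compl_eq_zero]
  intro x hx
  rw [Set.notMem_compl_iff, Set.mem_singleton_iff] at hx
  rw [hx, h0]

end LimitLaw

/-! ### Almost sure convergence of the spectral distributions. -/

theorem theorem4p1 {Ω : Type*} [MeasurableSpace Ω] (P : Measure Ω) [IsProbabilityMeasure P]
    (c : ℝ) (hc : 0 < c) (m : ℕ+ → ℕ+)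
    (hm : Tendsto (fun n : ℕ+ => ((m n : ℕ) : ℝ) / ((n : ℕ) : ℝ)) atTop (𝓝 c))
    (v : (n : ℕ+) → Ω → RandomStates.UnitVector 1 (m n) n)
    (hv : ∀ n : ℕ+, HasLaw (v n) (RandomStates.uniformUnitVector 1 (m n) n) P) :
    ∃ μ : ProbabilityMeasure ℝ,
      (∀ s : Set ℝ, MeasurableSet s →
        (μ : Measure ℝ).real s =
          (1 - 1 / c) * (Measure.dirac (0 : ℝ)).real s +
            1 / c * (RandomStates.signedSqrtProductLaw (RandomStates.freePoisson c 1)).real s) ∧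
      ∀ᵐ ω ∂P, Tendsto (fun n : ℕ+ => RandomStates.empiricalPT (v n ω)) atTop (𝓝 μ) := by
  have := isProbabilityMeasure_freePoisson hc
  set ν := RandomStates.signedSqrtProductLaw (RandomStates.freePoisson c 1) with hν
  set R : ℝ := (1 + √c) ^ 2 with hR
  have hR0 : 0 ≤ R := by positivity
  have hb : 0 ≤ 1 / c := by positivity
  -- The mass at `0` is `(ν {0} - (1 - c)) / c`, and `ν {0} ≥ 1 - c` by the atom of a single `X₁`.
  have h0 : 0 ≤ (1 - 1 / c) + 1 / c * ν.real {0} := by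
    have h1 : 1 - c ≤ ν.real {0} := by
      have := (ofReal_one_sub_le_freePoisson_singleton hc).trans
        (le_signedSqrtProductLaw_singleton _)
      exact (ENNReal.ofReal_le_iff_le_toReal (measure_ne_top _ _)).1 this
    have h2 : 1 - 1 / c + 1 / c * ν.real {0} = (ν.real {0} - (1 - c)) / c := by
      field_simp; ring
    rw [h2]
    exact div_nonneg (by linarith) hc.le
  have hprob := isProbabilityMeasure_diracCombination hb h0 (by ring)
  have hνR : ∀ᵐ x ∂ν, |x| ≤ R := ae_abs_le_signedSqrtProductLaw hR0 (ae_mem_Icc_freePoisson hc)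
  have hνint (p : ℕ) : Integrable (fun x : ℝ => x ^ p) ν := by
    refine Integrable.of_bound (by fun_prop) (R ^ p) ?_
    filter_upwards [hνR] with x hx
    rw [norm_pow]
    exact pow_le_pow_left₀ (norm_nonneg _) hx p
  refine ⟨⟨diracCombination (1 - 1 / c) (1 / c) ν, hprob⟩,
    fun s hs => diracCombination_real hb h0 hs, ?_⟩
  filter_upwards [ae_all_iff.2 fun k => ae_tendsto_powerTrace P hc hm v hv k] with ω hω
  refine tendsto_of_tendsto_moments hR0 ?_ (fun n p => integrable_empiricalDistribution _ _ _)
    fun p => ?_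
  · exact ae_diracCombination (measurableSet_le measurable_abs measurable_const)
      (by simpa using hR0) hνR
  · change Tendsto _ _ (𝓝 (∫ x, x ^ p ∂diracCombination (1 - 1 / c) (1 / c) ν))
    rcases Nat.even_or_odd' p with ⟨k, rfl | rfl⟩
    · rcases eq_or_ne k 0 with rfl | hk
      · simp only [mul_zero, pow_zero, integral_const, probReal_univ, smul_eq_mul, mul_one]
        exact tendsto_const_nhds
      · rw [integral_diracCombination hb (hνint _) (zero_pow (by omega)),
          integral_pow_even_signedSqrtProductLaw
            ((ae_mem_Icc_freePoisson hc).mono fun x hx => hx.1), integral_pow_freePoisson hc hk,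
          one_div]
        simp_rw [integral_pow_even_empiricalPT _ hk]
        exact (hm.inv₀ hc.ne').mul ((hω k).pow 2)
    · rw [integral_diracCombination hb (hνint _) (zero_pow (by omega)),
        integral_pow_odd_signedSqrtProductLaw, mul_zero]
      simp_rw [integral_pow_odd_empiricalPT]
      have h1 : Tendsto (fun n : ℕ+ => ((m n : ℕ) : ℝ)⁻¹) atTop (𝓝 0) := by
        have h2 : Tendsto (fun n : ℕ+ => ((n : ℕ) : ℝ)⁻¹) atTop (𝓝 0) :=
          tendsto_inv_atTop_zero.comp (tendsto_natCast_atTop_atTop.comp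
            tendsto_PNat_val_atTop_atTop)
        have h3 := (hm.inv₀ hc.ne').mul h2
        rw [mul_zero] at h3
        refine h3.congr fun n => ?_
        have : ((n : ℕ) : ℝ) ≠ 0 := by exact_mod_cast n.ne_zero
        field_simp
      simpa using h1.mul (hω (2 * k + 1))
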